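/- For a square-free integer $d>1$ let $\mathrm{Cl}(-d)$ denote the ideal class group of the ring of integers of the imaginary quadratic field $\mathbb{Q}(\sqrt{-d})$. Let $l\ge 2$ be an integer and let $g_1\ge 3$ be an odd integer. Then for every real $\varepsilon>0$ there exist constants $c>0$ and $X_0$, depending only on $l$, $g_1$ and $\varepsilon$, such that for all real $X\ge X_0$ $$\#\{\,1<d\le X:\ d \text{ square-free and there is an injective group homomorphism } (\mathbb{Z}/2\mathbb{Z})^l\times\mathbb{Z}/g_1\mathbb{Z}\hookrightarrow \mathrm{Cl}(-d)\,\}\ \ge\ c\,X^{\frac12+\frac{3}{2g_1+2}-\varepsilon}.$$ -/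

import Mathlib

open scoped NumberField IntermediateField

noncomputable section

/-- The imaginary quadratic field `ℚ(√-d)`, as the subfield of `ℂ` generated by `√-d = i√d`. -/
abbrev ImagQuadField (d : ℕ) : IntermediateField ℚ ℂ :=
  ℚ⟮Complex.I * ((Real.sqrt (d : ℝ) : ℝ) : ℂ)⟯

/-- The class group `Cl(-d)` of the ring of integers of `ℚ(√-d)`. -/
abbrev ImagQuadClassGroup (d : ℕ) : Type :=
  ClassGroup (𝓞 (ImagQuadField d))

/-- The additively written abelian group `H` embeds into `Cl(-d)`: there is an injective group
homomorphism `H → Cl(-d)`. -/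
def EmbedsInClassGroup (H : Type) [AddCommGroup H] (d : ℕ) : Prop :=
  ∃ f : Multiplicative H →* ImagQuadClassGroup d, Function.Injective f

/-- The square-free integers `1 < d ≤ X` such that `H` embeds into `Cl(-d)`. -/
def classGroupSet (H : Type) [AddCommGroup H] (X : ℝ) : Set ℕ :=
  {d : ℕ | 1 < d ∧ Squarefree d ∧ (d : ℝ) ≤ X ∧ EmbedsInClassGroup H d}

theorem classGroupSet_finite (H : Type) [AddCommGroup H] (X : ℝ) :
    (classGroupSet H X).Finite :=
  (Set.finite_Iic ⌊X⌋₊).subset fun _ hd => Nat.le_floor hd.2.2.1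

/-- The counting function `N_H(X)`, the number of square-free integers `1 < d ≤ X` such that
`H` embeds into `Cl(-d)`. The set counted is finite by `classGroupSet_finite`. -/
def classGroupCount (H : Type) [AddCommGroup H] (X : ℝ) : ℕ :=
  (classGroupSet H X).ncard

end

/-! Write g₁ = g = k + 2. The integers d are produced from representations m^g = n² + t²d with m
coprime to 2n. Then n + t√-d is coprime to its conjugate, so it generates the g-th power of an ideal
𝔞. Everything about classes rests on one fact, `ImagQuad.eq_intCast_of_normSq_lt`: an integer of
ℚ(√-d) of norm below d/4 is rational. If 𝔞^(g/p) were principal for a prime p ∣ g, its generator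
would have norm m^(g/p) ≤ m^(g/3) < d/4, hence be rational, which is absurd as t > 0; so 𝔞 has order
g (`ImagQuad.exists_orderOf_eq`). For the 2-part, d is forced to be divisible by a fixed odd
square-free P with at least l prime factors. The ramified primes above l of these have principal
squares, and no non-empty subproduct is principal: a generator would be a rational integer whose
square is a square-free number greater than 1.

For the count, take a parameter Y, primes t of size Y^k, products m of two primes of size Y³, and n
< Y^(3k+6), so that d has size X = Y^(4k+12). For given t and m, n runs through a residue class
modulo 2P²t², about Y^(k+6) values. This makes Y^(2k+12) triples up to small losses, and
(2k+12)/(4k+12) = 1/2 + 3/(2g+2).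

It remains to see that most d are square-free and that few coincide. Squares of primes q ≤ Y^(k+4)
are removed by a sieve in n (`le_two_mul_card_sieved`). A larger q gives m^g = n² + (tq)²e with e of
size at most Y^(2k+4), and for given m and e there are boundedly many solutions
(`card_representations_le`), so only O(Y^(2k+10)) triples are lost. If two triples share d, then
t₁²m₂^g − t₂²m₁^g factors as (t₁n₂ − t₂n₁)(t₁n₂ + t₂n₁), so the divisor bound leaves few pairs (n₁,
n₂) off the diagonal (`card_collisions_le`). Cauchy–Schwarz then turns the number of triples into a
number of distinct d. The density of primes and the divisor function cost only powers of a factor L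
of size Y^η, absorbed by ε. -/

open scoped NumberField IntermediateField

noncomputable section

/-! ### Group theory: assembling (ℤ/2)^l × ℤ/g -/

/-- Commuting involutions without relations, together with an element of odd order `g`, generate a
copy of `(ℤ/2)^l × ℤ/g`. -/
theorem exists_injective_hom_of_involutions {G : Type*} [CommGroup G] {l g : ℕ}
    (hodd : Odd g) (c : Fin l → G) (hc : ∀ i, c i ^ 2 = 1)
    (hind : ∀ I : Finset (Fin l), ∏ i ∈ I, c i = 1 → I = ∅) (a : G) (ha : orderOf a = g) :
    ∃ f : Multiplicative ((Fin l → ZMod 2) × ZMod g) →* G, Function.Injective f := by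
  have hg : NeZero g := ⟨by rintro rfl; simp at hodd⟩
  let φ : Multiplicative ((Fin l → ZMod 2) × ZMod g) →* G :=
    { toFun := fun x => (∏ i, c i ^ (x.toAdd.1 i).val) * a ^ (x.toAdd.2).val
      map_one' := by simp
      map_mul' := by
        intro x y
        have h2 : ∀ i, c i ^ ((x.toAdd.1 i + y.toAdd.1 i : ZMod 2)).val =
            c i ^ (x.toAdd.1 i).val * c i ^ (y.toAdd.1 i).val := by
          intro i
          rw [ZMod.val_add, ← pow_add]
          exact (pow_eq_pow_mod _ (hc i)).symm
        have h1 : a ^ (x.toAdd.2 + y.toAdd.2).val = a ^ x.toAdd.2.val * a ^ y.toAdd.2.val := by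
          rw [ZMod.val_add, ← pow_add]
          exact (pow_eq_pow_mod _ (ha ▸ pow_orderOf_eq_one a)).symm
        simp only [toAdd_mul, Prod.fst_add, Prod.snd_add, Pi.add_apply, h1, h2,
          Finset.prod_mul_distrib]
        exact mul_mul_mul_comm _ _ _ _ }
  refine ⟨φ, (injective_iff_map_eq_one φ).2 fun x hx => ?_⟩
  have hx' : (∏ i, c i ^ (x.toAdd.1 i).val) * a ^ (x.toAdd.2).val = 1 := hx
  -- Squaring kills the involutions, so a has its exponent doubled; as g is odd, that exponent
  -- vanishes.
  have hsq : (∏ i, c i ^ (x.toAdd.1 i).val) ^ 2 = 1 := by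
    rw [← Finset.prod_pow]
    refine Finset.prod_eq_one fun i _ => ?_
    rw [← pow_mul, mul_comm, pow_mul, hc, one_pow]
  have ha2 : a ^ (x.toAdd.2.val * 2) = 1 := by
    have := congrArg (· ^ 2) hx'
    simpa [mul_pow, hsq, pow_mul] using this
  have hv : x.toAdd.2.val = 0 := by
    have h := orderOf_dvd_of_pow_eq_one ha2
    rw [ha] at h
    have h' : g ∣ x.toAdd.2.val :=
      Nat.Coprime.dvd_of_dvd_mul_right (Nat.coprime_two_right.2 hodd) h
    exact Nat.eq_zero_of_dvd_of_lt h' (ZMod.val_lt _)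
  rw [hv, pow_zero, mul_one] at hx'
  have hprod : ∏ i ∈ Finset.univ.filter (fun i => x.toAdd.1 i ≠ 0), c i = 1 := by
    rw [← hx', Finset.prod_filter]
    refine Finset.prod_congr rfl fun i _ => ?_
    generalize x.toAdd.1 i = y
    obtain rfl | rfl : y = 0 ∨ y = 1 := by revert y; decide
    · simp
    · simp [ZMod.val_one]
  have hI := hind _ hprod
  have h1 : x.toAdd.1 = 0 := by
    funext i
    by_contra h
    have : i ∈ Finset.univ.filter (fun i => x.toAdd.1 i ≠ 0) := by simpa using h
    simp [hI] at this
  have h2 : x.toAdd.2 = 0 := (ZMod.val_eq_zero _).1 hv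
  exact Multiplicative.toAdd.injective (Prod.ext h1 h2)

/-! ### Integers of small norm in ℚ(√-d) -/

namespace ImagQuad

variable (d : ℕ)

/-- The generator `i√d` as a complex number. -/
def root : ℂ := Complex.I * ((Real.sqrt (d : ℝ) : ℝ) : ℂ)

theorem root_sq : root d ^ 2 = -(d : ℂ) := by
  rw [root, mul_pow, Complex.I_sq, ← Complex.ofReal_pow, Real.sq_sqrt (Nat.cast_nonneg d)]
  simp

theorem root_mul_self : root d * root d = -(d : ℂ) := by
  rw [← sq, root_sq]

theorem conj_root : (starRingEnd ℂ) (root d) = -root d := by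
  simp [root]

theorem isIntegral_root : IsIntegral ℤ (root d) := by
  refine IsIntegral.of_pow (n := 2) two_pos ?_
  rw [root_sq]
  simpa using (isIntegral_algebraMap (R := ℤ) (A := ℂ) (x := -(d : ℤ)))

theorem root_mem : root d ∈ ImagQuadField d := IntermediateField.mem_adjoin_simple_self ℚ _

theorem exists_rat_coords {z : ℂ} (hz : z ∈ ImagQuadField d) :
    ∃ x y : ℚ, z = x + y * root d := by
  have hint : IsIntegral ℚ (root d) := (isIntegral_root d).tower_top
  have h : z ∈ Algebra.adjoin ℚ {root d} := by
    have := IntermediateField.adjoin_simple_toSubalgebra_of_isAlgebraic hint.isAlgebraic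
    rw [← this]
    exact hz
  induction h using Algebra.adjoin_induction with
  | mem x hx => exact ⟨0, 1, by simpa using hx⟩
  | algebraMap r => exact ⟨r, 0, by simp⟩
  | add a b ha' hb' ha hb =>
    have hle := IntermediateField.algebra_adjoin_le_adjoin ℚ {root d}
    obtain ⟨x, y, rfl⟩ := ha (hle ha')
    obtain ⟨u, v, rfl⟩ := hb (hle hb')
    exact ⟨x + u, y + v, by push_cast; ring⟩
  | mul a b ha' hb' ha hb =>
    have hle := IntermediateField.algebra_adjoin_le_adjoin ℚ {root d}
    obtain ⟨x, y, rfl⟩ := ha (hle ha')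
    obtain ⟨u, v, rfl⟩ := hb (hle hb')
    refine ⟨x * u - d * (y * v), x * v + y * u, ?_⟩
    push_cast
    linear_combination ((y : ℂ) * v) * root_sq d

theorem isIntegral_conj {z : ℂ} (hz : IsIntegral ℤ z) : IsIntegral ℤ ((starRingEnd ℂ) z) :=
  map_isIntegral_int (starRingEnd ℂ) hz

theorem exists_int_of_isIntegral_rat {q : ℚ} (hq : IsIntegral ℤ (q : ℂ)) :
    ∃ k : ℤ, q = k := by
  have : IsIntegral ℤ q :=
    (isIntegral_algebraMap_iff (algebraMap ℚ ℂ).injective).1 (by simpa using hq)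
  obtain ⟨k, hk⟩ := IsIntegrallyClosed.isIntegral_iff.1 this
  exact ⟨k, by simpa using hk.symm⟩

variable {d}

theorem normSq_coords (x y : ℚ) :
    Complex.normSq (x + y * root d) = ((x ^ 2 + y ^ 2 * d : ℚ) : ℝ) := by
  have h : ((Complex.normSq (x + y * root d) : ℝ) : ℂ) = (((x ^ 2 + y ^ 2 * d : ℚ) : ℝ) : ℂ) := by
    rw [← Complex.mul_conj]
    simp only [map_add, map_mul, conj_root, map_ratCast]
    push_cast
    linear_combination (-(y : ℂ) ^ 2) * root_sq d
  exact_mod_cast h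

theorem exists_nat_normSq (α : 𝓞 (ImagQuadField d)) :
    ∃ N : ℕ, Complex.normSq ((α : ImagQuadField d) : ℂ) = N := by
  obtain ⟨x, y, hxy⟩ := exists_rat_coords d (α : ImagQuadField d).2
  have hα : IsIntegral ℤ ((α : ImagQuadField d) : ℂ) :=
    (NumberField.RingOfIntegers.isIntegral_coe α).map ((ImagQuadField d).val.restrictScalars ℤ)
  have h := hα.mul (isIntegral_conj hα)
  rw [Complex.mul_conj, hxy, normSq_coords] at h
  obtain ⟨k, hk⟩ := exists_int_of_isIntegral_rat (q := x ^ 2 + y ^ 2 * d) (by exact_mod_cast h)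
  have hk0 : 0 ≤ k := by
    have : (0 : ℚ) ≤ k := by rw [← hk]; positivity
    exact_mod_cast this
  lift k to ℕ using hk0
  refine ⟨k, ?_⟩
  rw [hxy, normSq_coords, hk]
  simp

/-- An integer of `ℚ(√-d)` whose norm is less than `d / 4` is rational. -/
theorem eq_intCast_of_normSq_lt (hd : Squarefree d) (α : 𝓞 (ImagQuadField d))
    (h : 4 * Complex.normSq ((α : ImagQuadField d) : ℂ) < d) : ∃ z : ℤ, α = z := by
  obtain ⟨x, y, hxy⟩ := exists_rat_coords d (α : ImagQuadField d).2
  have hα : IsIntegral ℤ ((α : ImagQuadField d) : ℂ) :=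
    (NumberField.RingOfIntegers.isIntegral_coe α).map ((ImagQuadField d).val.restrictScalars ℤ)
  obtain ⟨N, hN⟩ := exists_nat_normSq α
  have hc : (starRingEnd ℂ) ((α : ImagQuadField d) : ℂ) = x - y * root d := by
    rw [hxy]; simp [conj_root, sub_eq_add_neg]
  obtain ⟨a, ha⟩ := exists_int_of_isIntegral_rat (q := 2 * x) (by
    have := hα.add (isIntegral_conj hα)
    rw [hc, hxy] at this
    have e : ((2 * x : ℚ) : ℂ) = x + y * root d + (x - y * root d) := by push_cast; ring
    rwa [e])
  obtain ⟨w, hw⟩ := exists_int_of_isIntegral_rat (q := -(2 * y * d)) (by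
    have := (hα.sub (isIntegral_conj hα)).mul (isIntegral_root d)
    rw [hc, hxy] at this
    have e : ((-(2 * y * d) : ℚ) : ℂ) = (x + y * root d - (x - y * root d)) * root d := by
      push_cast
      linear_combination (-2 * (y : ℂ)) * root_sq d
    rwa [e])
  have hNq : (N : ℚ) = x ^ 2 + y ^ 2 * d := by
    have : (N : ℝ) = ((x ^ 2 + y ^ 2 * d : ℚ) : ℝ) := by rw [← hN, hxy, normSq_coords]
    exact_mod_cast this
  have hd0 : 0 < d := Nat.pos_of_ne_zero hd.ne_zero
  -- Here a = 2x and w = -2yd are the traces of α and α√-d. Since d is square-free it divides w, so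
  -- 4N = a² + dv² with v = w/d, and v ≠ 0 would force 4N ≥ d. No case distinction on d modulo 4 is
  -- needed.
  have hkd : (4 * N - a ^ 2) * d = w ^ 2 := by
    have : ((4 * N - a ^ 2) * d : ℚ) = w ^ 2 := by
      rw [← hw, ← ha, hNq]; ring
    exact_mod_cast this
  have hdw : (d : ℤ) ∣ w := by
    have : (d : ℤ) ∣ w ^ 2 := Dvd.intro_left _ hkd
    exact (Int.squarefree_natCast.2 hd).isRadical 2 w this
  obtain ⟨v, rfl⟩ := hdw
  have hd0' : (0 : ℤ) < d := by exact_mod_cast hd0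
  have hkv : 4 * N - a ^ 2 = d * v ^ 2 := by
    have : (4 * N - a ^ 2) * d = (d * v ^ 2) * (d : ℤ) := by rw [hkd]; ring
    exact mul_right_cancel₀ hd0'.ne' this
  have h4N : (4 * N : ℤ) < d := by
    rw [hN] at h
    exact_mod_cast h
  have hv : v = 0 := by
    by_contra hv
    have : 1 ≤ v ^ 2 := Int.one_le_abs hv |> fun h => by nlinarith [sq_abs v]
    nlinarith [sq_nonneg a]
  have hy : y = 0 := by
    subst hv
    have hdq : (d : ℚ) ≠ 0 := by exact_mod_cast hd0.ne'
    simpa [hdq] using hw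
  have hαx : ((α : ImagQuadField d) : ℂ) = x := by simp [hxy, hy]
  obtain ⟨z, hz⟩ := exists_int_of_isIntegral_rat (q := x) (by rw [← hαx]; exact hα)
  refine ⟨z, ?_⟩
  apply NumberField.RingOfIntegers.ext
  apply Subtype.ext
  rw [hαx, hz]
  simp

end ImagQuad

/-! ### Ideal classes of order two and of order g -/

namespace ImagQuad

variable {d : ℕ}

instance : NumberField (ImagQuadField d) where
  to_charZero := inferInstance
  to_finiteDimensional :=
    IntermediateField.adjoin.finiteDimensional (isIntegral_root d).tower_top

/-- `√-d` as an algebraic integer. -/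
def rootInt (d : ℕ) : 𝓞 (ImagQuadField d) :=
  ⟨⟨root d, root_mem d⟩, by
    rw [mem_integralClosure_iff]
    exact (isIntegral_algebraMap_iff (algebraMap (ImagQuadField d) ℂ).injective).1
      (isIntegral_root d)⟩

theorem coe_rootInt : ((rootInt d : ImagQuadField d) : ℂ) = root d := rfl

/-- The square of the complex absolute value on the ring of integers. -/
def nrm (d : ℕ) : 𝓞 (ImagQuadField d) →*₀ ℝ where
  toFun α := Complex.normSq ((α : ImagQuadField d) : ℂ)
  map_zero' := by simp
  map_one' := by simp
  map_mul' := by simp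

theorem nrm_apply (α : 𝓞 (ImagQuadField d)) :
    nrm d α = Complex.normSq ((α : ImagQuadField d) : ℂ) := rfl

theorem nrm_intCast (z : ℤ) : nrm d z = (z : ℝ) ^ 2 := by
  simp [nrm_apply, ← Complex.ofReal_intCast, Complex.normSq_ofReal, sq]

theorem nrm_natCast (z : ℕ) : nrm d z = (z : ℝ) ^ 2 := by
  exact_mod_cast nrm_intCast (d := d) z

theorem nrm_nonneg (α : 𝓞 (ImagQuadField d)) : 0 ≤ nrm d α := Complex.normSq_nonneg _

theorem nrm_unit (u : (𝓞 (ImagQuadField d))ˣ) : nrm d u = 1 := by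
  obtain ⟨a, ha⟩ := exists_nat_normSq (u : 𝓞 (ImagQuadField d))
  obtain ⟨b, hb⟩ := exists_nat_normSq ((u⁻¹ : (𝓞 (ImagQuadField d))ˣ) : 𝓞 (ImagQuadField d))
  have h : nrm d u * nrm d (u⁻¹ : (𝓞 (ImagQuadField d))ˣ) = 1 := by
    rw [← map_mul, Units.mul_inv, map_one]
  rw [nrm_apply, nrm_apply, ha, hb] at h
  have h' : a * b = 1 := by exact_mod_cast h
  rw [nrm_apply, ha, Nat.eq_one_of_mul_eq_one_right h']
  simp

theorem nrm_eq_of_associated {α β : 𝓞 (ImagQuadField d)} (h : Associated α β) :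
    nrm d α = nrm d β := by
  obtain ⟨u, rfl⟩ := h
  rw [map_mul, nrm_unit, mul_one]

theorem rootInt_mul_self : rootInt d * rootInt d = -(d : 𝓞 (ImagQuadField d)) := by
  apply NumberField.RingOfIntegers.ext
  apply Subtype.ext
  simpa [coe_rootInt] using root_mul_self d

/-- The ramified ideal above a divisor `p` of `d`. -/
def ramified (d p : ℕ) : Ideal (𝓞 (ImagQuadField d)) := Ideal.span {(p : 𝓞 _), rootInt d}

/-- The square is generated by p², p√-d and pe, where d = pe. Square-freeness makes p and e coprime,
so p is a combination of p² and pe. -/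
theorem ramified_sq (hd : Squarefree d) {p : ℕ} (hpd : p ∣ d) :
    ramified d p ^ 2 = Ideal.span {(p : 𝓞 (ImagQuadField d))} := by
  obtain ⟨e, rfl⟩ := hpd
  have hcop : IsCoprime (p : ℤ) (e : ℤ) :=
    Nat.isCoprime_iff_coprime.2 (Nat.squarefree_mul_iff.1 hd).1
  obtain ⟨a, b, hab⟩ := hcop
  have hab' : (a : 𝓞 (ImagQuadField (p * e))) * p + b * e = 1 := by
    exact_mod_cast congrArg (Int.cast : ℤ → 𝓞 (ImagQuadField (p * e))) hab
  have hroot := rootInt_mul_self (d := p * e)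
  push_cast at hroot
  rw [ramified, sq, Ideal.span_pair_mul_span_pair]
  apply le_antisymm
  · rw [Ideal.span_le]
    rintro x (rfl | rfl | rfl | rfl) <;> rw [SetLike.mem_coe, Ideal.mem_span_singleton]
    · exact dvd_mul_right _ _
    · exact dvd_mul_right _ _
    · exact dvd_mul_left _ _
    · rw [hroot]
      exact (dvd_mul_right _ _).neg_right
  · rw [Ideal.span_singleton_le_iff_mem]
    have : (p : 𝓞 (ImagQuadField (p * e))) =
        a * (p * p) + (-b) * (rootInt (p * e) * rootInt (p * e)) := by
      rw [hroot]
      linear_combination (-(p : 𝓞 (ImagQuadField (p * e)))) * hab'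
    have hmem : (a : 𝓞 (ImagQuadField (p * e))) * (p * p) +
        (-b) * (rootInt (p * e) * rootInt (p * e)) ∈ Ideal.span
          {(p : 𝓞 (ImagQuadField (p * e))) * p, p * rootInt (p * e), rootInt (p * e) * p,
            rootInt (p * e) * rootInt (p * e)} :=
      Ideal.add_mem _ (Ideal.mul_mem_left _ _ (Ideal.subset_span (by simp)))
        (Ideal.mul_mem_left _ _ (Ideal.subset_span (by simp)))
    rwa [← this] at hmem

theorem natCast_ne_zero {p : ℕ} (hp : p ≠ 0) : (p : 𝓞 (ImagQuadField d)) ≠ 0 := by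
  exact_mod_cast hp

theorem ramified_ne_zero {p : ℕ} (hp : p ≠ 0) : ramified d p ≠ 0 := by
  intro h
  have : (p : 𝓞 (ImagQuadField d)) ∈ ramified d p := Ideal.subset_span (by simp)
  rw [h, Ideal.zero_eq_bot, Ideal.mem_bot] at this
  exact natCast_ne_zero hp this

/-- A product of distinct ramified primes is not principal as soon as its norm is small. -/
theorem prod_ramified_not_principal (hd : Squarefree d) {ι : Type*} [Fintype ι] (p : ι → ℕ)
    (hpinj : Function.Injective p) (hp : ∀ i, (p i).Prime) (hpd : ∀ i, p i ∣ d)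
    (hlt : 4 * ∏ i, p i < d) (I : Finset ι)
    (hI : Submodule.IsPrincipal (∏ i ∈ I, ramified d (p i))) : I = ∅ := by
  classical
  obtain ⟨α, hα⟩ := hI
  rw [Ideal.submodule_span_eq] at hα
  set N := ∏ i ∈ I, p i with hN
  have hN0 : 0 < N := Finset.prod_pos fun i _ => (hp i).pos
  have hspan : Ideal.span {α ^ 2} = Ideal.span {(N : 𝓞 (ImagQuadField d))} := by
    rw [← Ideal.span_singleton_pow, ← hα, ← Finset.prod_pow, hN, Nat.cast_prod,
      ← Ideal.prod_span_singleton]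
    exact Finset.prod_congr rfl fun i _ => ramified_sq hd (hpd i)
  have hnrm := nrm_eq_of_associated (Ideal.span_singleton_eq_span_singleton.1 hspan)
  rw [map_pow, nrm_natCast, pow_left_inj₀ (nrm_nonneg _) (Nat.cast_nonneg _) two_ne_zero] at hnrm
  have hNle : N ≤ ∏ i, p i :=
    Finset.prod_le_prod_of_subset_of_one_le' (Finset.subset_univ I) fun i _ _ => (hp i).one_le
  obtain ⟨z, hz⟩ := eq_intCast_of_normSq_lt hd α (by
    rw [← nrm_apply, hnrm]
    exact_mod_cast (by omega : 4 * N < d))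
  rw [hz, nrm_intCast] at hnrm
  have hz2 : z ^ 2 = N := by exact_mod_cast hnrm
  have hNd : N ∣ d := by
    have : ∏ q ∈ I.image p, q ∣ d := by
      apply Finset.prod_primes_dvd
      · intro a ha
        obtain ⟨i, _, rfl⟩ := Finset.mem_image.1 ha
        exact (hp i).prime
      · intro a ha
        obtain ⟨i, _, rfl⟩ := Finset.mem_image.1 ha
        exact hpd i
    rwa [Finset.prod_image fun i _ j _ h => hpinj h] at this
  have hNsq : Squarefree (N : ℤ) := Int.squarefree_natCast.2 (hd.squarefree_of_dvd hNd)
  -- N is both the square z² and square-free, being a divisor of d.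
  have hzu : IsUnit z := hNsq z (by rw [← hz2, sq])
  have hN1 : N = 1 := by
    rw [Int.isUnit_iff] at hzu
    have : (N : ℤ) = 1 := by rcases hzu with rfl | rfl <;> simpa using hz2.symm
    exact_mod_cast this
  refine Finset.eq_empty_of_forall_notMem fun i hi => (hp i).one_lt.ne' ?_
  exact Nat.dvd_one.1 (hN1 ▸ Finset.dvd_prod_of_mem p hi)

/-- A representation `m ^ g = n ^ 2 + t ^ 2 d` with small `m` produces an ideal class of order
exactly `g`. -/
theorem exists_orderOf_eq (hd : Squarefree d) {g m n t : ℕ} (hg : 0 < g) (hodd : Odd g)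
    (hsmall : 64 * m ^ g < d ^ 3) (heq : m ^ g = n ^ 2 + t ^ 2 * d) (ht : 0 < t)
    (hcop : Nat.Coprime m (2 * n)) : ∃ a : ImagQuadClassGroup d, orderOf a = g := by
  set β : 𝓞 (ImagQuadField d) := n + t * rootInt d with hβ
  set β' : 𝓞 (ImagQuadField d) := n - t * rootInt d with hβ'
  have hd0 : 0 < d := Nat.pos_of_ne_zero hd.ne_zero
  have hm0 : 0 < m := by
    rcases Nat.eq_zero_or_pos m with rfl | h
    · rw [zero_pow hg.ne'] at heq
      have : 0 < t ^ 2 * d := by positivity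
      omega
    · exact h
  have hmul : β * β' = (m : 𝓞 (ImagQuadField d)) ^ g := by
    have : (m : 𝓞 (ImagQuadField d)) ^ g = n ^ 2 + t ^ 2 * d := by
      exact_mod_cast congrArg (Nat.cast : ℕ → 𝓞 (ImagQuadField d)) heq
    rw [this, hβ, hβ']
    linear_combination (-(t : 𝓞 (ImagQuadField d)) ^ 2) * rootInt_mul_self (d := d)
  -- The ideal generated by β and β' contains ββ' = m^g and β + β' = 2n, which are coprime integers.
  have hcp : IsCoprime β β' := by
    have h1 : IsCoprime ((m : ℤ) ^ g) (2 * n : ℤ) := by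
      have := Nat.isCoprime_iff_coprime.2 hcop
      push_cast at this
      exact this.pow_left
    obtain ⟨a, b, hab⟩ := h1
    have hab' : (a : 𝓞 (ImagQuadField d)) * m ^ g + b * (2 * n) = 1 := by
      exact_mod_cast congrArg (Int.cast : ℤ → 𝓞 (ImagQuadField d)) hab
    refine ⟨a * β' + b, b, ?_⟩
    rw [← hab', ← hmul, hβ, hβ']
    ring
  have hid : Ideal.span {β} * Ideal.span {β'} = Ideal.span {(m : 𝓞 (ImagQuadField d))} ^ g := by
    rw [Ideal.span_singleton_mul_span_singleton, hmul, Ideal.span_singleton_pow]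
  obtain ⟨𝔞, h𝔞⟩ := exists_eq_pow_of_mul_eq_pow_of_coprime
    ((Ideal.isCoprime_span_singleton_iff _ _).2 hcp) hid
  have hnβ : nrm d β * nrm d β' = ((m : ℝ) ^ g) ^ 2 := by
    rw [← map_mul, hmul, map_pow, nrm_natCast, ← pow_mul, ← pow_mul, mul_comm]
  have hβeq : nrm d β = (m : ℝ) ^ g := by
    have := normSq_coords (d := d) n t
    push_cast at this
    have e : ((β : ImagQuadField d) : ℂ) = n + t * root d := by simp [hβ, coe_rootInt]
    rw [nrm_apply, e, this]
    exact_mod_cast heq.symm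
  have hβ0 : β ≠ 0 := by
    intro h
    rw [h, map_zero] at hβeq
    have : (0 : ℝ) < (m : ℝ) ^ g := by positivity
    linarith
  have h𝔞0 : 𝔞 ≠ 0 := by
    rintro rfl
    rw [zero_pow hg.ne'] at h𝔞
    exact hβ0 (by simpa using h𝔞)
  have hpow : ∀ r : ℕ, ClassGroup.mk0 ⟨𝔞, mem_nonZeroDivisors_of_ne_zero h𝔞0⟩ ^ r = 1 ↔
      Submodule.IsPrincipal (𝔞 ^ r) := by
    intro r
    rw [← map_pow, ← ClassGroup.mk0_eq_one_iff
      (mem_nonZeroDivisors_of_ne_zero (pow_ne_zero r h𝔞0))]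
    rfl
  refine ⟨ClassGroup.mk0 ⟨𝔞, mem_nonZeroDivisors_of_ne_zero h𝔞0⟩,
    orderOf_eq_of_pow_and_pow_div_prime hg ?_ ?_⟩
  · rw [hpow, ← h𝔞]
    exact ⟨β, rfl⟩
  · intro p hp hpg h
    obtain ⟨r, hr⟩ := hpg
    rw [hpow, hr, Nat.mul_div_cancel_left _ hp.pos] at h
    obtain ⟨α, hα⟩ := h
    rw [Ideal.submodule_span_eq] at hα
    have hspan : Ideal.span {α ^ p} = Ideal.span {β} := by
      rw [h𝔞, hr, ← Ideal.span_singleton_pow, ← hα, ← pow_mul, mul_comm]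
    have hass := Ideal.span_singleton_eq_span_singleton.1 hspan
    have hn := nrm_eq_of_associated hass
    rw [map_pow, hβeq, hr, mul_comm p r, pow_mul,
      pow_left_inj₀ (nrm_nonneg _) (by positivity) hp.ne_zero] at hn
    -- Oddness of g excludes p = 2; this is why a bound for m^g against d³ suffices.
    have hp3 : 3 ≤ p := by
      have : p ≠ 2 := by
        rintro rfl
        rw [hr] at hodd
        exact (Nat.not_odd_iff_even.2 (even_two_mul r)) hodd
      have := hp.two_le
      omega
    have hlt : 4 * m ^ r < d := by
      have h1 : (m ^ r) ^ 3 ≤ m ^ g := by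
        rw [hr, mul_comm p r, pow_mul]
        exact Nat.pow_le_pow_right (by positivity) hp3
      refine lt_of_pow_lt_pow_left₀ 3 (Nat.zero_le _) ?_
      calc (4 * m ^ r) ^ 3 = 64 * (m ^ r) ^ 3 := by ring
        _ ≤ 64 * m ^ g := by omega
        _ < d ^ 3 := hsmall
    obtain ⟨z, hz⟩ := eq_intCast_of_normSq_lt hd α (by
      rw [← nrm_apply, hn]
      exact_mod_cast hlt)
    obtain ⟨u, hu⟩ := hass
    -- The unit has norm 1 < d/4 and is rational too, so β = α^p u would be rational, against its
    -- imaginary part t√d > 0.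
    obtain ⟨v, hv⟩ := eq_intCast_of_normSq_lt hd (u : 𝓞 (ImagQuadField d)) (by
      rw [← nrm_apply, nrm_unit]
      have h2 : 1 ≤ m ^ r := Nat.one_le_pow _ _ hm0
      have : 4 * 1 < d := by omega
      exact_mod_cast this)
    rw [hz, hv] at hu
    have hre : ((β : ImagQuadField d) : ℂ) = ((z ^ p * v : ℤ) : ℂ) := by
      rw [← hu]; simp
    have e : ((β : ImagQuadField d) : ℂ) = n + t * root d := by simp [hβ, coe_rootInt]
    have him := congrArg Complex.im (e.symm.trans hre)
    rw [Complex.intCast_im] at him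
    have hs : (0 : ℝ) < t * Real.sqrt d := by positivity
    simp [root] at him
    rcases him with h | h
    · omega
    · omega

end ImagQuad

/-- The sufficient condition for the embedding used in the counting argument. -/
theorem embedsInClassGroup_of_repr {l g d m n t : ℕ} (hd : Squarefree d) (hg : 0 < g)
    (hodd : Odd g) (p : Fin l → ℕ) (hpinj : Function.Injective p) (hp : ∀ i, (p i).Prime)
    (hpd : ∀ i, p i ∣ d) (hlt : 4 * ∏ i, p i < d) (hsmall : 64 * m ^ g < d ^ 3)
    (heq : m ^ g = n ^ 2 + t ^ 2 * d) (ht : 0 < t) (hcop : Nat.Coprime m (2 * n)) :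
    EmbedsInClassGroup ((Fin l → ZMod 2) × ZMod g) d := by
  obtain ⟨a, ha⟩ := ImagQuad.exists_orderOf_eq hd hg hodd hsmall heq ht hcop
  have hne : ∀ i, ImagQuad.ramified d (p i) ∈ nonZeroDivisors (Ideal (𝓞 (ImagQuadField d))) :=
    fun i => mem_nonZeroDivisors_of_ne_zero (ImagQuad.ramified_ne_zero (hp i).ne_zero)
  refine exists_injective_hom_of_involutions hodd
    (fun i => ClassGroup.mk0 ⟨ImagQuad.ramified d (p i), hne i⟩) ?_ ?_ a ha
  · intro i
    have h2 : ImagQuad.ramified d (p i) ^ 2 ∈ nonZeroDivisors (Ideal (𝓞 (ImagQuadField d))) :=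
      pow_mem (hne i) 2
    have := (ClassGroup.mk0_eq_one_iff h2).2
      ⟨(p i : 𝓞 (ImagQuadField d)), ImagQuad.ramified_sq hd (hpd i)⟩
    rw [← this, ← map_pow]
    rfl
  · intro I hI
    refine ImagQuad.prod_ramified_not_principal hd p hpinj hp hpd hlt I ?_
    rw [← map_prod] at hI
    have h2 : ∏ i ∈ I, ImagQuad.ramified d (p i) ∈
        nonZeroDivisors (Ideal (𝓞 (ImagQuadField d))) :=
      Submonoid.prod_mem _ fun i _ => hne i
    rw [← ClassGroup.mk0_eq_one_iff h2, ← hI]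
    congr 1
    apply Subtype.ext
    simp

/-! ### Counting by fibres and in residue classes -/

/-- Cauchy–Schwarz over the fibres of f, whose squared sizes add up to the number of pairs. It
serves twice: to find many pairs of primes with the same residue data, and to bound the number of
distinct d from below. -/
theorem Finset.sq_card_le_card_image_mul_card_pairs {α β : Type*} [DecidableEq β]
    (S : Finset α) (f : α → β) :
    S.card ^ 2 ≤ (S.image f).card * ((S ×ˢ S).filter fun x => f x.1 = f x.2).card := by
  classical
  have h1 : S.card = ∑ b ∈ S.image f, (S.filter fun a => f a = b).card :=
    Finset.card_eq_sum_card_image f S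
  have h2 : ((S ×ˢ S).filter fun x => f x.1 = f x.2).card =
      ∑ b ∈ S.image f, (S.filter fun a => f a = b).card ^ 2 := by
    rw [Finset.card_eq_sum_card_fiberwise (f := fun x : α × α => f x.1) (t := S.image f)]
    · refine Finset.sum_congr rfl fun b _ => ?_
      rw [sq, ← Finset.card_product]
      congr 1
      ext ⟨x, y⟩
      simp only [Finset.mem_filter, Finset.mem_product]
      constructor
      · rintro ⟨⟨⟨hx, hy⟩, h⟩, rfl⟩
        exact ⟨⟨hx, rfl⟩, hy, h.symm⟩
      · rintro ⟨⟨hx, rfl⟩, hy, h⟩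
        exact ⟨⟨⟨hx, hy⟩, h.symm⟩, rfl⟩
    · rintro ⟨x, y⟩ hx
      simp only [Finset.coe_filter, Finset.mem_product, Set.mem_ofPred_eq] at hx
      exact Finset.mem_coe.2 (Finset.mem_image_of_mem f hx.1.1)
  rw [h2]
  conv_lhs => rw [h1]
  exact sq_sum_le_card_mul_sum_sq

theorem Finset.card_le_div_add_one_of_modEq {S : Finset ℕ} {N D : ℕ}
    (hS : ∀ n ∈ S, n < N) (hmod : ∀ a ∈ S, ∀ b ∈ S, (D : ℤ) ∣ (a : ℤ) - b) :
    S.card ≤ N / D + 1 := by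
  calc S.card ≤ (Finset.range (N / D + 1)).card := by
        refine Finset.card_le_card_of_injOn (fun n => n / D) ?_ ?_
        · intro n hn
          rw [Finset.coe_range, Set.mem_Iio, Nat.lt_succ_iff]
          exact Nat.div_le_div_right (hS n hn).le
        · intro a ha b hb hab
          have h1 : a % D = b % D :=
            ((Nat.modEq_iff_dvd (n := D)).2 (hmod a ha b hb) : b ≡ a [MOD D]).symm
          have h2 : a / D = b / D := hab
          rw [← Nat.div_add_mod a D, ← Nat.div_add_mod b D, h1, h2]
    _ = N / D + 1 := Finset.card_range _

theorem div_le_card_filter_modEq (N D r : ℕ) :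
    N / D ≤ ((Finset.range N).filter fun n => n ≡ r [MOD D]).card := by
  rcases Nat.eq_zero_or_pos D with rfl | hD
  · simp
  calc N / D = (Finset.range (N / D)).card := (Finset.card_range _).symm
    _ ≤ _ := by
      refine Finset.card_le_card_of_injOn (fun k => r % D + D * k) ?_ ?_
      · intro k hk
        rw [Finset.coe_range, Set.mem_Iio] at hk
        simp only [Finset.coe_filter, Finset.mem_range, Set.mem_ofPred_eq]
        constructor
        · have h1 := Nat.mod_lt r hD
          have h2 : D * (k + 1) ≤ D * (N / D) := Nat.mul_le_mul_left _ hk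
          have h3 := Nat.mul_div_le N D
          nlinarith
        · simp [Nat.ModEq]
      · intro a _ b _ hab
        have : D * a = D * b := by simpa using hab
        exact Nat.eq_of_mul_eq_mul_left hD this

/-! ### Representations by x² + dy² -/

/-- In Brahmagupta's identity (xx' + dyy')² + d(xy' − x'y)² = K² the first square is positive, so
|xy' − x'y| < K. -/
theorem cross_eq_zero_of_dvd {x y x' y' d K : ℤ} (h : x ^ 2 + y ^ 2 * d = K)
    (h' : x' ^ 2 + y' ^ 2 * d = K) (hd : 0 < d) (hx : 0 < x) (hx' : 0 < x') (hy : 0 < y)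
    (hy' : 0 < y') (hK : K ∣ x * y' - x' * y) : x * y' - x' * y = 0 := by
  obtain ⟨k, hk⟩ := hK
  have hid : (x * x' + d * (y * y')) ^ 2 + d * (x * y' - x' * y) ^ 2 = K * K := by
    nth_rewrite 1 [← h]
    rw [← h']
    ring
  by_contra hne
  have hk0 : k ≠ 0 := by rintro rfl; exact hne (by simpa using hk)
  have hk2 : 1 ≤ k ^ 2 := Int.add_one_le_iff.2 (by positivity : (0 : ℤ) < k ^ 2)
  have hp : 0 < (x * x' + d * (y * y')) ^ 2 := by positivity
  rw [hk] at hid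
  have h1 : 1 * (K * K) ≤ d * k ^ 2 * (K * K) :=
    mul_le_mul_of_nonneg_right (by nlinarith) (mul_self_nonneg K)
  linarith [mul_assoc d (k ^ 2) (K * K), mul_pow K k 2,
    (by ring : d * (K * k) ^ 2 = d * k ^ 2 * (K * K))]

/-- The number of coprime representations of an odd integer `K` by `x² + d y²` is at most the
number of divisors of `K`. -/
theorem card_representations_le {K d : ℕ} (hK : Odd K) (hd : 0 < d) (R : Finset (ℕ × ℕ))
    (hR : ∀ z ∈ R, 0 < z.1 ∧ 0 < z.2 ∧ z.1 ^ 2 + z.2 ^ 2 * d = K ∧ Nat.Coprime z.1 K) :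
    R.card ≤ K.divisors.card := by
  rcases R.eq_empty_or_nonempty with rfl | ⟨⟨x₀, y₀⟩, h₀⟩
  · simp
  have hK0 : K ≠ 0 := by rintro rfl; simp at hK
  have hcy : ∀ z ∈ R, Nat.Coprime z.2 K := by
    intro z hz
    obtain ⟨-, -, h, hc⟩ := hR z hz
    refine Nat.Coprime.symm (Nat.coprime_of_dvd fun q hq hqK hqy => ?_)
    have : q ∣ z.1 ^ 2 := by
      rw [← Nat.dvd_add_left (Dvd.dvd.mul_right (dvd_pow hqy two_ne_zero) d), h]
      exact hqK
    exact hq.one_lt.ne' (Nat.eq_one_of_dvd_coprimes hc (hq.dvd_of_dvd_pow this) hqK)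
  obtain ⟨hx0, hy0, hrep0, hc0⟩ := hR _ h₀
  have hcy0 := hcy _ h₀
  simp only at hx0 hy0 hrep0 hc0 hcy0
  -- A representation is recovered from e = gcd(xy₀ − x₀y, K). As K divides (xy₀ − x₀y)(xy₀ + x₀y),
  -- the cofactor f = K/e divides xy₀ + x₀y. If two representations share e, then e and f both
  -- divide xy' − x'y; being coprime, they make K divide it, so it is zero and the two coprime pairs
  -- agree.
  refine Finset.card_le_card_of_injOn
    (fun z => Int.gcd ((z.1 : ℤ) * y₀ - x₀ * z.2) K) ?_ ?_
  · intro z _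
    rw [Finset.mem_coe, Nat.mem_divisors]
    exact ⟨Int.natCast_dvd_natCast.1 (Int.gcd_dvd_right ..), hK0⟩
  rintro ⟨x, y⟩ hz ⟨x', y'⟩ hz' hzz
  have hcxy := hcy _ hz
  obtain ⟨hx, hy, hrep, hc⟩ := hR _ hz
  obtain ⟨hx', hy', hrep', hc'⟩ := hR _ hz'
  simp only at hzz hx hy hrep hc hx' hy' hrep' hc' hcxy
  have compl : ∀ a b : ℕ, a ^ 2 + b ^ 2 * d = K → ∀ f : ℕ,
      K = Int.gcd ((a : ℤ) * y₀ - x₀ * b) K * f → (f : ℤ) ∣ (a : ℤ) * y₀ + x₀ * b := by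
    intro a b hab f hf
    set e := Int.gcd ((a : ℤ) * y₀ - x₀ * b) K with he
    have he0 : 0 < e := Nat.pos_of_ne_zero fun h => hK0 (by rw [hf, h, zero_mul])
    have hprod : (K : ℤ) ∣ ((a : ℤ) * y₀ - x₀ * b) * ((a : ℤ) * y₀ + x₀ * b) := by
      refine ⟨(y₀ : ℤ) ^ 2 - b ^ 2, ?_⟩
      have h1 : (K : ℤ) = a ^ 2 + b ^ 2 * d := by exact_mod_cast hab.symm
      have h2 : (K : ℤ) = x₀ ^ 2 + y₀ ^ 2 * d := by exact_mod_cast hrep0.symm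
      linear_combination (-(y₀ : ℤ) ^ 2) * h1 + (b : ℤ) ^ 2 * h2
    obtain ⟨k, hk⟩ : (e : ℤ) ∣ (a : ℤ) * y₀ - x₀ * b := Int.gcd_dvd_left ..
    have hcop : IsCoprime k (f : ℤ) := by
      rw [Int.isCoprime_iff_gcd_eq_one]
      have h3 : e * Int.gcd k f = e := by
        have h4 := Int.gcd_mul_left e k f
        rw [← hk] at h4
        have h5 : ((e : ℤ) * f) = K := by exact_mod_cast hf.symm
        rw [h5, ← he] at h4
        simpa using h4.symm
      exact Nat.eq_of_mul_eq_mul_left he0 (by simpa using h3)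
    have h5 : (K : ℤ) = e * f := by exact_mod_cast hf
    rw [hk, h5, mul_assoc] at hprod
    have h6 := (mul_dvd_mul_iff_left (by exact_mod_cast he0.ne' : (e : ℤ) ≠ 0)).1 hprod
    exact hcop.symm.dvd_of_dvd_mul_left h6
  obtain ⟨f, hf⟩ : Int.gcd ((x : ℤ) * y₀ - x₀ * y) K ∣ K := by
    exact_mod_cast Int.gcd_dvd_right ((x : ℤ) * y₀ - x₀ * y) K
  have hf1 := compl x y hrep f hf
  have hf2 := compl x' y' hrep' f (by rw [← hzz]; exact hf)
  set e := Int.gcd ((x : ℤ) * y₀ - x₀ * y) K with he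
  have he1 : (e : ℤ) ∣ (x : ℤ) * y₀ - x₀ * y := Int.gcd_dvd_left ..
  have he2 : (e : ℤ) ∣ (x' : ℤ) * y₀ - x₀ * y' := by
    rw [hzz]
    exact Int.gcd_dvd_left ..
  have hcop : ∀ w : ℕ, w ∣ K → IsCoprime (w : ℤ) (y₀ : ℤ) := fun w hw =>
    Nat.isCoprime_iff_coprime.2 ((hcy0.coprime_dvd_right hw).symm)
  have hed : (e : ℤ) ∣ (x : ℤ) * y' - x' * y := by
    refine (hcop e ⟨f, hf⟩).dvd_of_dvd_mul_left (?_ : (e : ℤ) ∣ y₀ * _)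
    have : (y₀ : ℤ) * (x * y' - x' * y) = (x * y₀ - x₀ * y) * y' - (x' * y₀ - x₀ * y') * y := by
      ring
    rw [this]
    exact (he1.mul_right _).sub (he2.mul_right _)
  have hfd : (f : ℤ) ∣ (x : ℤ) * y' - x' * y := by
    refine (hcop f ⟨e, by rw [hf]; ring⟩).dvd_of_dvd_mul_left (?_ : (f : ℤ) ∣ y₀ * _)
    have : (y₀ : ℤ) * (x * y' - x' * y) = (x * y₀ + x₀ * y) * y' - (x' * y₀ + x₀ * y') * y := by
      ring
    rw [this]
    exact (hf1.mul_right _).sub (hf2.mul_right _)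
  -- A common prime would divide the sum 2xy₀ of the two forms, which is prime to K; here K odd is
  -- needed.
  have hef : IsCoprime (e : ℤ) (f : ℤ) := by
    rw [Nat.isCoprime_iff_coprime]
    refine Nat.coprime_of_dvd fun q hq hqe hqf => ?_
    have hqK : q ∣ K := hf ▸ hqe.mul_right f
    have h1 : (q : ℤ) ∣ 2 * x * y₀ := by
      have : (2 * x * y₀ : ℤ) = (x * y₀ - x₀ * y) + (x * y₀ + x₀ * y) := by ring
      rw [this]
      exact ((Int.natCast_dvd_natCast.2 hqe).trans he1).add
        ((Int.natCast_dvd_natCast.2 hqf).trans hf1)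
    have h2 : q ∣ 2 * x * y₀ := by exact_mod_cast h1
    have h3 : Nat.Coprime (2 * x * y₀) K :=
      ((Nat.coprime_two_left.2 hK).mul_left hc).mul_left hcy0
    exact hq.one_lt.ne' (Nat.eq_one_of_dvd_coprimes h3 h2 hqK)
  have hKd : (K : ℤ) ∣ (x : ℤ) * y' - x' * y := by
    have : (K : ℤ) = e * f := by exact_mod_cast hf
    rw [this]
    exact hef.mul_dvd hed hfd
  have hzero : (x : ℤ) * y' - x' * y = 0 :=
    cross_eq_zero_of_dvd (d := (d : ℤ)) (by exact_mod_cast hrep) (by exact_mod_cast hrep')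
      (by exact_mod_cast hd) (by exact_mod_cast hx) (by exact_mod_cast hx')
      (by exact_mod_cast hy) (by exact_mod_cast hy') hKd
  have heq : x * y' = x' * y := by
    have : (x : ℤ) * y' = x' * y := by linarith
    exact_mod_cast this
  have hcop2 : ∀ a b : ℕ, a ^ 2 + b ^ 2 * d = K → Nat.Coprime a K → Nat.Coprime a b := by
    intro a b hab hc
    refine Nat.coprime_of_dvd fun q hq hqa hqb => ?_
    have : q ∣ K := hab ▸ (dvd_pow hqa two_ne_zero).add ((dvd_pow hqb two_ne_zero).mul_right d)
    exact hq.one_lt.ne' (Nat.eq_one_of_dvd_coprimes hc hqa this)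
  have hxx : x = x' := Nat.dvd_antisymm
    ((hcop2 x y hrep hc).dvd_of_dvd_mul_right (Dvd.intro _ heq))
    ((hcop2 x' y' hrep' hc').dvd_of_dvd_mul_right (Dvd.intro _ heq.symm))
  subst hxx
  have hyy : y' = y := Nat.eq_of_mul_eq_mul_left hx heq
  rw [hyy]

theorem card_divisors_mul_le (a b : ℕ) :
    (a * b).divisors.card ≤ a.divisors.card * b.divisors.card := by
  rw [Nat.divisors_mul]
  exact Finset.card_mul_le

theorem card_divisors_semiprime_pow_le {p q : ℕ} (hp : p.Prime) (hq : q.Prime) (g : ℕ) :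
    ((p * q) ^ g).divisors.card ≤ (g + 1) ^ 2 := by
  rw [mul_pow, sq]
  refine (card_divisors_mul_le _ _).trans ?_
  rw [Nat.divisors_prime_pow hp, Nat.divisors_prime_pow hq]
  simp

/-! ### Coincidences among the d, and large square factors -/

/-- Coincidences between the values `d` in `m ^ g = n ^ 2 + t ^ 2 d`: the diagonal contributes
`|S|`, and away from it the pair `(n₁, n₂)` comes from a divisor of `t₁² m₂ ^ g - t₂² m₁ ^ g`. -/
theorem card_collisions_le {g τ : ℕ} (hg : g ≠ 0) (T M : Finset ℕ) (S : Finset (ℕ × ℕ × ℕ))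
    (f : ℕ × ℕ × ℕ → ℕ)
    (hS : ∀ s ∈ S, s.1 ∈ T ∧ s.2.1 ∈ M ∧ 0 < s.2.2 ∧
      s.2.1 ^ g = s.2.2 ^ 2 + s.1 ^ 2 * f s ∧ s.1.Prime ∧ ¬ s.1 ∣ s.2.1)
    (hτ : ∀ t₁ ∈ T, ∀ t₂ ∈ T, ∀ m₁ ∈ M, ∀ m₂ ∈ M,
      ((t₁ : ℤ) ^ 2 * (m₂ : ℤ) ^ g - (t₂ : ℤ) ^ 2 * (m₁ : ℤ) ^ g).natAbs.divisors.card ≤ τ) :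
    ((S ×ˢ S).filter fun x => f x.1 = f x.2).card ≤ S.card + (T.card * M.card) ^ 2 * τ := by
  classical
  set E := (S ×ˢ S).filter fun x => f x.1 = f x.2 with hE
  have hfac : ∀ x ∈ E, ((x.1.1 : ℤ) ^ 2 * (x.2.2.1 : ℤ) ^ g - (x.2.1 : ℤ) ^ 2 * (x.1.2.1 : ℤ) ^ g)
      = (x.1.1 * x.2.2.2 - x.2.1 * x.1.2.2) * (x.1.1 * x.2.2.2 + x.2.1 * x.1.2.2) := by
    rintro ⟨⟨t₁, m₁, n₁⟩, ⟨t₂, m₂, n₂⟩⟩ hx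
    rw [hE, Finset.mem_filter, Finset.mem_product] at hx
    obtain ⟨⟨h1, h2⟩, hf⟩ := hx
    obtain ⟨-, -, -, e1, -, -⟩ := hS _ h1
    obtain ⟨-, -, -, e2, -, -⟩ := hS _ h2
    simp only at e1 e2 hf ⊢
    rw [hf] at e1
    have e1' : (m₁ : ℤ) ^ g = n₁ ^ 2 + t₁ ^ 2 * f (t₂, m₂, n₂) := by exact_mod_cast e1
    have e2' : (m₂ : ℤ) ^ g = n₂ ^ 2 + t₂ ^ 2 * f (t₂, m₂, n₂) := by exact_mod_cast e2
    rw [e1', e2']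
    ring
  have hdiag : (E.filter fun x => x.1 = x.2).card ≤ S.card := by
    refine Finset.card_le_card_of_injOn (fun x => x.1) ?_ ?_
    · intro x hx
      simp only [hE, Finset.coe_filter, Finset.mem_filter, Finset.mem_product,
        Set.mem_ofPred_eq] at hx
      exact hx.1.1.1
    · rintro ⟨a, b⟩ hx ⟨c, e⟩ hy hxy
      simp only [Finset.coe_filter, Set.mem_ofPred_eq] at hx hy hxy
      rw [← hx.2, ← hy.2, hxy]
  have hoff : (E.filter fun x => ¬ x.1 = x.2).card ≤ τ * (((T ×ˢ M) ×ˢ (T ×ˢ M)).card) := by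
    refine Finset.card_le_mul_card_image_of_maps_to
      (f := fun x => ((x.1.1, x.1.2.1), (x.2.1, x.2.2.1))) ?_ _ ?_
    · rintro ⟨s, s'⟩ hx
      simp only [hE, Finset.mem_filter, Finset.mem_product] at hx
      obtain ⟨ht, hm, -⟩ := hS _ hx.1.1.1
      obtain ⟨ht', hm', -⟩ := hS _ hx.1.1.2
      simp only [Finset.mem_product]
      exact ⟨⟨ht, hm⟩, ht', hm'⟩
    · rintro ⟨⟨t₁, m₁⟩, ⟨t₂, m₂⟩⟩ hk
      simp only [Finset.mem_product] at hk
      refine le_trans ?_ (hτ t₁ hk.1.1 t₂ hk.2.1 m₁ hk.1.2 m₂ hk.2.2)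
      -- With the t's and m's fixed, t₁n₂ + t₂n₁ divides a fixed non-zero integer. It determines the
      -- complementary factor t₁n₂ − t₂n₁, hence n₁ and n₂.
      refine Finset.card_le_card_of_injOn (fun x => x.1.1 * x.2.2.2 + x.2.1 * x.1.2.2) ?_ ?_
      · rintro ⟨⟨t, m, n⟩, ⟨t', m', n'⟩⟩ hx
        simp only [Finset.coe_filter, Finset.mem_filter, Set.mem_ofPred_eq, Prod.mk.injEq] at hx
        obtain ⟨⟨hxE, hne⟩, ⟨rfl, rfl⟩, rfl, rfl⟩ := hx
        have hf := hfac _ hxE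
        simp only [hE, Finset.mem_filter, Finset.mem_product] at hxE
        obtain ⟨-, -, hn, -, hp, hpm⟩ := hS _ hxE.1.1
        obtain ⟨-, -, hn', -, hp', hpm'⟩ := hS _ hxE.1.2
        simp only at hf hn hn' hp hp' hpm hpm'
        rw [Finset.mem_coe, Nat.mem_divisors, Int.natAbs_ne_zero]
        constructor
        · rw [← Int.natCast_dvd, hf]
          push_cast
          exact dvd_mul_left _ _
        -- Off the diagonal the integer is non-zero: otherwise t₁ divides t₂²m₁^g, and since t₁ does
        -- not divide m₁ the primes agree, then the m's, then the n's.
        · intro h0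
          have h1 : t ^ 2 * m' ^ g = t' ^ 2 * m ^ g := by
            have := sub_eq_zero.1 h0
            exact_mod_cast this
          have htt : t = t' := by
            have h2 : t ∣ t' ^ 2 * m ^ g := h1 ▸ (dvd_pow_self t two_ne_zero).mul_right _
            rcases (Nat.Prime.dvd_mul hp).1 h2 with h | h
            · exact (Nat.prime_dvd_prime_iff_eq hp hp').1 (hp.dvd_of_dvd_pow h)
            · exact absurd (hp.dvd_of_dvd_pow h) hpm
          subst htt
          have hmm : m' = m := by
            have h3 := Nat.eq_of_mul_eq_mul_left (by have := hp.pos; positivity) h1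
            exact Nat.pow_left_injective hg h3
          subst hmm
          rw [h0] at hf
          have ht0 : (0 : ℤ) < t := by exact_mod_cast hp.pos
          have hpos : (0 : ℤ) < t * n' + t * n := by positivity
          rcases mul_eq_zero.1 hf.symm with h | h
          · have h4 : (t : ℤ) * n' = t * n := by linarith
            have h5 := mul_left_cancel₀ ht0.ne' h4
            exact hne ⟨rfl, rfl, by exact_mod_cast h5.symm⟩
          · omega
      · rintro ⟨⟨t, m, n⟩, ⟨t', m', n'⟩⟩ hx ⟨⟨u, k, l⟩, ⟨u', k', l'⟩⟩ hy hxy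
        simp only [Finset.coe_filter, Finset.mem_filter, Set.mem_ofPred_eq, Prod.mk.injEq] at hx hy
        obtain ⟨⟨hxE, -⟩, ⟨rfl, rfl⟩, rfl, rfl⟩ := hx
        obtain ⟨⟨hyE, -⟩, ⟨rfl, rfl⟩, rfl, rfl⟩ := hy
        have hf := hfac _ hxE
        have hf' := hfac _ hyE
        simp only [hE, Finset.mem_filter, Finset.mem_product] at hxE
        obtain ⟨-, -, hn, -, hp, -⟩ := hS _ hxE.1.1
        obtain ⟨-, -, hn', -, hp', -⟩ := hS _ hxE.1.2
        simp only at hf hf' hxy hn hn' hp hp'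
        have ht0 : (0 : ℤ) < u := by exact_mod_cast hp.pos
        have ht0' : (0 : ℤ) < u' := by exact_mod_cast hp'.pos
        have hxy' : (u : ℤ) * n' + u' * n = u * l' + u' * l := by exact_mod_cast hxy
        have hpos : (0 : ℤ) < u * n' + u' * n := by positivity
        rw [hf, ← hxy'] at hf'
        have h1 := mul_right_cancel₀ hpos.ne' hf'
        have h2 : (u : ℤ) * n' = u * l' := by linarith
        have h3 : (u' : ℤ) * n = u' * l := by linarith
        have h4 := mul_left_cancel₀ ht0.ne' h2
        have h5 := mul_left_cancel₀ ht0'.ne' h3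
        rw [show n' = l' by exact_mod_cast h4, show n = l by exact_mod_cast h5]
  rw [← Finset.card_filter_add_card_filter_not (s := E) fun x => x.1 = x.2]
  refine add_le_add hdiag (hoff.trans (le_of_eq ?_))
  simp only [Finset.card_product]
  ring

/-- Solutions of `m ^ g = n ^ 2 + (t q) ^ 2 e` with `e ≤ D`. -/
theorem card_large_square_le {g D τ : ℕ} (M : Finset ℕ) (L : Finset (ℕ × ℕ × ℕ))
    (hL : ∀ s ∈ L, s.1.Prime ∧ s.2.1 ∈ M ∧ 0 < s.2.2 ∧ Nat.Coprime s.2.2 (s.2.1 ^ g) ∧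
      ∃ q e : ℕ, q.Prime ∧ 0 < e ∧ e ≤ D ∧ s.2.1 ^ g = s.2.2 ^ 2 + (s.1 * q) ^ 2 * e)
    (hM : ∀ m ∈ M, Odd m ∧ (m ^ g).divisors.card ≤ τ) :
    L.card ≤ 2 * τ * (M.card * D) := by
  classical
  choose! hp hm hn hc q e hq he heD heq using hL
  have hcard : M.card * D = (M ×ˢ Finset.Icc 1 D).card := by simp
  rw [hcard]
  refine Finset.card_le_mul_card_image_of_maps_to (f := fun s => (s.2.1, e s)) ?_ _ ?_
  · intro s hs
    simp only [Finset.mem_product, Finset.mem_Icc]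
    exact ⟨hm s hs, he s hs, heD s hs⟩
  rintro ⟨m, d⟩ hmd
  simp only [Finset.mem_product, Finset.mem_Icc] at hmd
  set F := L.filter fun s => (s.2.1, e s) = (m, d) with hF
  have hFm : ∀ s ∈ F, s ∈ L ∧ s.2.1 = m ∧ e s = d := by
    intro s hs
    simpa [hF] using hs
  set R := F.image fun s => (s.2.2, s.1 * q s) with hR
  have hRcard : R.card ≤ τ := by
    refine (card_representations_le (K := m ^ g) (d := d) (hM m hmd.1).1.pow hmd.2.1 R ?_).trans
      (hM m hmd.1).2
    intro z hz
    obtain ⟨s, hs, rfl⟩ := Finset.mem_image.1 hz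
    obtain ⟨hsL, rfl, rfl⟩ := hFm s hs
    exact ⟨hn s hsL, Nat.mul_pos (hp s hsL).pos (hq s hsL).pos, (heq s hsL).symm, hc s hsL⟩
  -- The factor 2: the product tq determines the prime t up to two choices.
  refine (Finset.card_le_mul_card_image (f := fun s => (s.2.2, s.1 * q s)) F 2 ?_).trans
    (Nat.mul_le_mul_left 2 hRcard)
  intro z hz
  obtain ⟨s, hs, rfl⟩ := Finset.mem_image.1 hz
  have hsL := (hFm s hs).1
  have h2 : ({s.1, q s} : Finset ℕ).card ≤ 2 := Finset.card_le_two
  refine le_trans (Finset.card_le_card_of_injOn (fun x => x.1) ?_ ?_) h2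
  · intro x hx
    simp only [Finset.coe_filter, Set.mem_ofPred_eq, Prod.mk.injEq] at hx
    have hxL := (hFm x hx.1).1
    have hdvd : x.1 ∣ s.1 * q s := hx.2.2 ▸ dvd_mul_right _ _
    simp only [Finset.coe_insert, Finset.coe_singleton, Set.mem_insert_iff, Set.mem_singleton_iff]
    rcases (Nat.Prime.dvd_mul (hp x hxL)).1 hdvd with h | h
    · exact Or.inl ((Nat.prime_dvd_prime_iff_eq (hp x hxL) (hp s hsL)).1 h)
    · exact Or.inr ((Nat.prime_dvd_prime_iff_eq (hp x hxL) (hq s hsL)).1 h)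
  · intro x hx y hy hxy
    simp only [Finset.coe_filter, Set.mem_ofPred_eq, Prod.mk.injEq] at hx hy
    have hx2 := (hFm x hx.1).2.1
    have hy2 := (hFm y hy.1).2.1
    exact Prod.ext hxy (Prod.ext (hx2.trans hy2.symm) (hx.2.1.trans hy.2.1.symm))

/-! ### Sieving squares of primes in a residue class -/

section Sieve

variable {W t N : ℕ}

theorem card_le_of_modulus {B : Finset ℕ} {D k : ℕ} (hB : ∀ n ∈ B, n < N)
    (hmod : ∀ a ∈ B, ∀ b ∈ B, (D : ℤ) ∣ (a : ℤ) - b) (hk : ∀ a ∈ B, ∀ b ∈ B, (k : ℤ) ∣ (a : ℤ) - b)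
    (hcop : Nat.Coprime D k) : (B.card : ℝ) ≤ (N : ℝ) / D / k + 1 := by
  have h := Finset.card_le_div_add_one_of_modEq (S := B) (N := N) (D := D * k) hB
    fun a ha b hb => by
      push_cast
      exact (Nat.isCoprime_iff_coprime.2 hcop).mul_dvd (hmod a ha b hb) (hk a ha b hb)
  have h' : (B.card : ℝ) ≤ ((N / (D * k) : ℕ) : ℝ) + 1 := by exact_mod_cast h
  refine h'.trans (add_le_add_left ?_ 1)
  rw [div_div]
  exact_mod_cast Nat.cast_div_le (α := ℝ) (m := N) (n := D * k)

/-- When q is odd and prime to c, any two square roots of c modulo q² agree up to sign. This leaves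
two classes modulo q², each to be combined with the class modulo D. -/
theorem card_sieved_le_of_not_dvd {B : Finset ℕ} {D q : ℕ} {c : ℤ} (hB : ∀ n ∈ B, n < N)
    (hmod : ∀ a ∈ B, ∀ b ∈ B, (D : ℤ) ∣ (a : ℤ) - b) (hcop : Nat.Coprime D q) (hq : q.Prime)
    (hq2 : q ≠ 2) (hqc : ¬ (q : ℤ) ∣ c) (hdvd : ∀ n ∈ B, (q : ℤ) ^ 2 ∣ c - (n : ℤ) ^ 2) :
    (B.card : ℝ) ≤ 2 * ((N : ℝ) / D / q ^ 2 + 1) := by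
  rcases B.eq_empty_or_nonempty with rfl | ⟨n₀, hn₀⟩
  · simp only [Finset.card_empty, Nat.cast_zero]
    positivity
  have hqZ : Prime (q : ℤ) := Nat.prime_iff_prime_int.1 hq
  have hq0 : ¬ (q : ℤ) ∣ 2 * n₀ := by
    intro h
    rcases hqZ.dvd_or_dvd h with h | h
    · have : q ∣ 2 := by exact_mod_cast h
      exact hq2 ((Nat.prime_dvd_prime_iff_eq hq Nat.prime_two).1 this)
    · apply hqc
      have h1 := (dvd_pow_self (q : ℤ) two_ne_zero).trans (hdvd n₀ hn₀)
      have h2 : (q : ℤ) ∣ (n₀ : ℤ) ^ 2 := h.trans (dvd_pow_self _ two_ne_zero)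
      have := h1.add h2
      simpa using this
  have hsplit : ∀ n ∈ B, ((q ^ 2 : ℕ) : ℤ) ∣ (n : ℤ) - n₀ ∨ ((q ^ 2 : ℕ) : ℤ) ∣ (n : ℤ) + n₀ := by
    intro n hn
    have h1 : (q : ℤ) ^ 2 ∣ ((n : ℤ) - n₀) * (n + n₀) := by
      have := (hdvd n₀ hn₀).sub (hdvd n hn)
      rwa [show c - (n₀ : ℤ) ^ 2 - (c - (n : ℤ) ^ 2) = ((n : ℤ) - n₀) * (n + n₀) by ring] at this
    push_cast
    by_cases h2 : (q : ℤ) ∣ (n : ℤ) - n₀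
    · left
      have h3 : ¬ (q : ℤ) ∣ (n : ℤ) + n₀ := fun h4 => hq0 (by
        have := h4.sub h2
        rwa [show (n : ℤ) + n₀ - (n - n₀) = 2 * n₀ by ring] at this)
      exact (((hqZ.coprime_iff_not_dvd).2 h3).pow_left).dvd_of_dvd_mul_right h1
    · right
      exact (((hqZ.coprime_iff_not_dvd).2 h2).pow_left).dvd_of_dvd_mul_left h1
  classical
  set B₁ := B.filter fun n : ℕ => ((q ^ 2 : ℕ) : ℤ) ∣ (n : ℤ) - n₀ with hB₁
  set B₂ := B.filter fun n : ℕ => ((q ^ 2 : ℕ) : ℤ) ∣ (n : ℤ) + n₀ with hB₂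
  have hcop2 : Nat.Coprime D (q ^ 2) := hcop.pow_right 2
  have h1 : (B₁.card : ℝ) ≤ (N : ℝ) / D / (q ^ 2 : ℕ) + 1 := by
    refine card_le_of_modulus (B := B₁) (fun n hn => hB n (Finset.mem_filter.1 hn).1)
      (fun a ha b hb => hmod a (Finset.mem_filter.1 ha).1 b (Finset.mem_filter.1 hb).1)
      (fun a ha b hb => ?_) hcop2
    have := (Finset.mem_filter.1 ha).2.sub (Finset.mem_filter.1 hb).2
    simpa using this
  have h2 : (B₂.card : ℝ) ≤ (N : ℝ) / D / (q ^ 2 : ℕ) + 1 := by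
    refine card_le_of_modulus (B := B₂) (fun n hn => hB n (Finset.mem_filter.1 hn).1)
      (fun a ha b hb => hmod a (Finset.mem_filter.1 ha).1 b (Finset.mem_filter.1 hb).1)
      (fun a ha b hb => ?_) hcop2
    have := (Finset.mem_filter.1 ha).2.sub (Finset.mem_filter.1 hb).2
    simpa using this
  have h3 : B.card ≤ B₁.card + B₂.card := by
    refine (Finset.card_le_card (t := B₁ ∪ B₂) fun n hn => ?_).trans (Finset.card_union_le B₁ B₂)
    rw [Finset.mem_union, hB₁, hB₂, Finset.mem_filter, Finset.mem_filter]
    exact (hsplit n hn).imp (fun h => ⟨hn, h⟩) fun h => ⟨hn, h⟩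
  have h3' : (B.card : ℝ) ≤ B₁.card + B₂.card := by exact_mod_cast h3
  push_cast at h1 h2
  linarith

open scoped Classical in
/-- In a residue class modulo `W t²` on which `t² ∣ c - n²`, at least half of the integers `n < N`
have `(c - n²) / t²` free of squares of primes up to `Q`. -/
theorem le_two_mul_card_sieved {Q r q₀ p₁ p₂ : ℕ} {c : ℤ} (h2W : 2 ∣ W) (hW : 0 < W)
    (ht : t.Prime) (htW : Nat.Coprime t W) (hr : (t : ℤ) ^ 2 ∣ c - (r : ℤ) ^ 2)
    (htc : ¬ (t : ℤ) ∣ c) (hq₀W : ∀ q : ℕ, q.Prime → q ≤ q₀ → q ∣ W)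
    (hWfree : ∀ q : ℕ, q.Prime → q ∣ W → ∀ n : ℕ, n ≡ r [MOD W] → ¬ (q : ℤ) ^ 2 ∣ c - (n : ℤ) ^ 2)
    (hc : ∀ q : ℕ, q.Prime → (q : ℤ) ∣ c → q = p₁ ∨ q = p₂) (hp₁ : 16 ≤ p₁) (hp₂ : 16 ≤ p₂)
    (hq₀ : 16 ≤ q₀) (hN : 8 * (Q : ℝ) + 12 ≤ (N : ℝ) / (W * t ^ 2 : ℕ)) :
    (N : ℝ) / (W * t ^ 2 : ℕ) ≤ 2 * (((Finset.range N).filter fun n => n ≡ r [MOD W * t ^ 2] ∧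
      ∀ q : ℕ, q.Prime → q ≤ Q → ¬ ((q : ℤ) * t) ^ 2 ∣ c - (n : ℤ) ^ 2).card : ℝ) := by
  set H : ℝ := (N : ℝ) / (W * t ^ 2 : ℕ) with hH
  have hH0 : 0 ≤ H := by positivity
  set A := (Finset.range N).filter fun n => n ≡ r [MOD W * t ^ 2] with hA
  set G := (Finset.range N).filter fun n => n ≡ r [MOD W * t ^ 2] ∧
      ∀ q : ℕ, q.Prime → q ≤ Q → ¬ ((q : ℤ) * t) ^ 2 ∣ c - (n : ℤ) ^ 2 with hG
  set I := (Finset.range (Q + 1)).filter fun q => q.Prime ∧ ¬ q ∣ W with hI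
  let B : ℕ → Finset ℕ := fun q => A.filter fun n => ((q : ℤ) * t) ^ 2 ∣ c - (n : ℤ) ^ 2
  have hAN : ∀ n ∈ A, n < N := fun n hn => Finset.mem_range.1 (Finset.mem_filter.1 hn).1
  have hAmod : ∀ n ∈ A, n ≡ r [MOD W * t ^ 2] := fun n hn => (Finset.mem_filter.1 hn).2
  have hAdiff : ∀ a ∈ A, ∀ b ∈ A, ((W * t ^ 2 : ℕ) : ℤ) ∣ (a : ℤ) - b := fun a ha b hb =>
    (Nat.modEq_iff_dvd.1 ((hAmod b hb).trans (hAmod a ha).symm))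
  have ht2 : t ≠ 2 := by
    rintro rfl
    exact (by decide : (2 : ℕ) ≠ 1) (Nat.eq_one_of_dvd_coprimes htW dvd_rfl h2W)
  have htr : ¬ (t : ℤ) ∣ r := by
    intro h
    have h1 := ((dvd_pow_self (t : ℤ) two_ne_zero).trans hr).add (h.trans (dvd_pow_self _ two_ne_zero))
    exact htc (by simpa using h1)
  have hcover : A ⊆ G ∪ I.biUnion B := by
    intro n hn
    by_cases hnG : n ∈ G
    · exact Finset.mem_union_left _ hnG
    · refine Finset.mem_union_right _ (Finset.mem_biUnion.2 ?_)
      have h1 : ∃ q : ℕ, q.Prime ∧ q ≤ Q ∧ ((q : ℤ) * t) ^ 2 ∣ c - (n : ℤ) ^ 2 := by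
        by_contra hcon
        push Not at hcon
        exact hnG (Finset.mem_filter.2 ⟨(Finset.mem_filter.1 hn).1, hAmod n hn, hcon⟩)
      obtain ⟨q, hq, hqQ, hqd⟩ := h1
      refine ⟨q, Finset.mem_filter.2 ⟨Finset.mem_range.2 (by omega), hq, fun hqW => ?_⟩,
        Finset.mem_filter.2 ⟨hn, hqd⟩⟩
      refine hWfree q hq hqW n ((hAmod n hn).of_mul_right _) (dvd_trans ?_ hqd)
      rw [mul_pow]
      exact dvd_mul_right _ _
  have hAcard : H - 1 ≤ A.card := by
    have h1 : ((N / (W * t ^ 2) : ℕ) : ℝ) ≤ A.card := by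
      exact_mod_cast div_le_card_filter_modEq N (W * t ^ 2) r
    have h2 : H < ((N / (W * t ^ 2) : ℕ) : ℝ) + 1 := by
      rw [hH, ← Nat.floor_div_eq_div (K := ℝ)]
      exact Nat.lt_floor_add_one _
    linarith
  have hbound : ∀ q ∈ I, ((B q).card : ℝ) ≤ 2 * (H * ((q : ℝ) ^ 2)⁻¹ + 1) +
      if q ∈ ({p₁, p₂} : Finset ℕ) then H / 16 + 1 else 0 := by
    intro q hq
    obtain ⟨-, hqp, hqW⟩ := Finset.mem_filter.1 hq
    have hBA : ∀ n ∈ B q, n ∈ A := fun n hn => (Finset.mem_filter.1 hn).1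
    have hBd : ∀ n ∈ B q, ((q : ℤ) * t) ^ 2 ∣ c - (n : ℤ) ^ 2 := fun n hn =>
      (Finset.mem_filter.1 hn).2
    have hBN : ∀ n ∈ B q, n < N := fun n hn => hAN n (hBA n hn)
    have hBdiff : ∀ a ∈ B q, ∀ b ∈ B q, ((W * t ^ 2 : ℕ) : ℤ) ∣ (a : ℤ) - b :=
      fun a ha b hb => hAdiff a (hBA a ha) b (hBA b hb)
    have hqZ : Prime (q : ℤ) := Nat.prime_iff_prime_int.1 hqp
    have hq2 : q ≠ 2 := by rintro rfl; exact hqW h2W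
    have hqWc : Nat.Coprime W q := ((Nat.Prime.coprime_iff_not_dvd hqp).2 hqW).symm
    have hextra : 0 ≤ if q ∈ ({p₁, p₂} : Finset ℕ) then H / 16 + 1 else 0 := by
      split_ifs <;> positivity
    have hmain : 0 ≤ H * ((q : ℝ) ^ 2)⁻¹ := by positivity
    -- For q = t the condition reads t⁴ ∣ c − n². All these n lie in the class of r modulo t², where
    -- t does not divide 2r, so they agree modulo t⁴ and number at most H/t² + 1.
    by_cases hqt : q = t
    · subst hqt
      have h1 : ∀ a ∈ B q, ∀ b ∈ B q, ((q ^ 4 : ℕ) : ℤ) ∣ (a : ℤ) - b := by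
        intro a ha b hb
        have h2 : (q : ℤ) ^ 4 ∣ ((a : ℤ) - b) * (a + b) := by
          have := (hBd b hb).sub (hBd a ha)
          rwa [show c - (b : ℤ) ^ 2 - (c - (a : ℤ) ^ 2) = ((a : ℤ) - b) * (a + b) by ring,
            show ((q : ℤ) * q) ^ 2 = (q : ℤ) ^ 4 by ring] at this
        have hmodq : ∀ x ∈ B q, (q : ℤ) ∣ (x : ℤ) - r := by
          intro x hx
          have h3 := Nat.modEq_iff_dvd.1 (hAmod x (hBA x hx)).symm
          refine dvd_trans ?_ h3
          push_cast
          exact (dvd_pow_self (q : ℤ) two_ne_zero).mul_left _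
        have h4 : ¬ (q : ℤ) ∣ (a : ℤ) + b := by
          intro h
          have h5 : (q : ℤ) ∣ 2 * r := by
            have := (h.sub (hmodq a ha)).sub (hmodq b hb)
            rwa [show (a : ℤ) + b - (a - r) - (b - r) = 2 * r by ring] at this
          rcases hqZ.dvd_or_dvd h5 with h | h
          · have : q ∣ 2 := by exact_mod_cast h
            exact hq2 ((Nat.prime_dvd_prime_iff_eq hqp Nat.prime_two).1 this)
          · exact htr h
        push_cast
        exact (((hqZ.coprime_iff_not_dvd).2 h4).pow_left).dvd_of_dvd_mul_right h2
      have h6 := card_le_of_modulus (D := W) hBN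
        (fun a ha b hb => dvd_trans (by push_cast; exact dvd_mul_right _ _) (hBdiff a ha b hb))
        h1 (hqWc.pow_right 4)
      have h7 : (N : ℝ) / W / (q ^ 4 : ℕ) = H * ((q : ℝ) ^ 2)⁻¹ := by
        rw [hH]
        push_cast
        have : (q : ℝ) ≠ 0 := by exact_mod_cast hqp.ne_zero
        field_simp
      rw [h7] at h6
      linarith
    · have hcop : Nat.Coprime (W * t ^ 2) q :=
        hqWc.mul_left (((Nat.coprime_primes ht hqp).2 (Ne.symm hqt)).pow_left 2)
      -- If q ∣ c, then q is p₁ or p₂, and only q ∣ n is used; q ≥ 16 makes this saving sufficient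
      -- for two primes.
      by_cases hqc : (q : ℤ) ∣ c
      · have hmem : q ∈ ({p₁, p₂} : Finset ℕ) := by simpa using hc q hqp hqc
        rw [if_pos hmem]
        have hqn : ∀ n ∈ B q, (q : ℤ) ∣ n := by
          intro n hn
          have h1 : (q : ℤ) ∣ c - (n : ℤ) ^ 2 := by
            refine dvd_trans ?_ (hBd n hn)
            rw [mul_pow]
            exact (dvd_pow_self _ two_ne_zero).mul_right _
          have h2 := hqc.sub h1
          rw [sub_sub_cancel] at h2
          exact hqZ.dvd_of_dvd_pow h2
        have h1 := card_le_of_modulus hBN hBdiff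
          (fun a ha b hb => (hqn a ha).sub (hqn b hb)) hcop
        have hq16 : (16 : ℝ) ≤ q := by
          rcases hc q hqp hqc with h | h <;> rw [h] <;> assumption_mod_cast
        have h2 : H / q ≤ H / 16 := div_le_div_of_nonneg_left hH0 (by norm_num) hq16
        linarith
      · have h1 := card_sieved_le_of_not_dvd hBN hBdiff hcop hqp hq2 hqc
          (fun n hn => dvd_trans (by rw [mul_pow]; exact dvd_mul_right _ _) (hBd n hn))
        have h2 : H / (q : ℝ) ^ 2 = H * ((q : ℝ) ^ 2)⁻¹ := div_eq_mul_inv _ _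
        rw [← hH, h2] at h1
        linarith
  -- The sum of q⁻² over q > q₀ is at most 1/q₀ ≤ 1/16, so at most H/4 + 2Q + 2 elements are
  -- removed. Since A has at least H − 1 elements, H/2 of them survive as soon as H ≥ 8Q + 12, which
  -- is `hN`.
  have hsum : ∑ q ∈ I, ((B q).card : ℝ) ≤ 2 * (H * (1 / 16) + Q) + 2 * (H / 16 + 1) := by
    refine (Finset.sum_le_sum hbound).trans ?_
    rw [Finset.sum_add_distrib, ← Finset.mul_sum, Finset.sum_add_distrib, ← Finset.mul_sum]
    have hIcard : ∑ q ∈ I, (1 : ℝ) ≤ Q := by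
      rw [Finset.sum_const, nsmul_one]
      have : I ⊆ Finset.Icc 1 Q := by
        intro q hq
        obtain ⟨h1, h2, -⟩ := Finset.mem_filter.1 hq
        rw [Finset.mem_range] at h1
        exact Finset.mem_Icc.2 ⟨h2.one_le, by omega⟩
      have := Finset.card_le_card this
      rw [Nat.card_Icc] at this
      exact_mod_cast this
    have hIinv : ∑ q ∈ I, ((q : ℝ) ^ 2)⁻¹ ≤ 1 / 16 := by
      have hsub : I ⊆ Finset.Ioc q₀ (max q₀ Q) := by
        intro q hq
        obtain ⟨h1, h2, h3⟩ := Finset.mem_filter.1 hq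
        rw [Finset.mem_range] at h1
        refine Finset.mem_Ioc.2 ⟨?_, le_max_of_le_right (by omega)⟩
        by_contra h4
        exact h3 (hq₀W q h2 (by omega))
      refine (Finset.sum_le_sum_of_subset_of_nonneg hsub fun _ _ _ => by positivity).trans ?_
      refine (sum_Ioc_inv_sq_le_sub (by omega) (le_max_left _ _)).trans ?_
      have h1 : ((q₀ : ℝ))⁻¹ ≤ 1 / 16 := by
        rw [inv_eq_one_div]
        exact one_div_le_one_div_of_le (by norm_num) (by exact_mod_cast hq₀)
      have h2 : (0 : ℝ) ≤ ((max q₀ Q : ℕ) : ℝ)⁻¹ := by positivity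
      linarith
    have hex : ∑ q ∈ I, (if q ∈ ({p₁, p₂} : Finset ℕ) then H / 16 + 1 else 0) ≤
        2 * (H / 16 + 1) := by
      rw [← Finset.sum_filter, Finset.sum_const, nsmul_eq_mul]
      have h1 : (I.filter fun q => q ∈ ({p₁, p₂} : Finset ℕ)).card ≤ 2 :=
        (Finset.card_le_card fun q hq => (Finset.mem_filter.1 hq).2).trans Finset.card_le_two
      have h2 : ((I.filter fun q => q ∈ ({p₁, p₂} : Finset ℕ)).card : ℝ) ≤ 2 := by exact_mod_cast h1
      exact mul_le_mul_of_nonneg_right h2 (by positivity)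
    have h3 : H * ∑ q ∈ I, ((q : ℝ) ^ 2)⁻¹ ≤ H * (1 / 16) :=
      mul_le_mul_of_nonneg_left hIinv hH0
    linarith
  have hfinal : (A.card : ℝ) ≤ G.card + ∑ q ∈ I, ((B q).card : ℝ) := by
    have h1 : A.card ≤ G.card + ∑ q ∈ I, (B q).card :=
      (Finset.card_le_card hcover).trans ((Finset.card_union_le _ _).trans
        (Nat.add_le_add_left Finset.card_biUnion_le _))
    exact_mod_cast h1
  linarith

end Sieve

/-! ### The divisor bound and the supply of primes -/

/-- The quotient of the divisor function by n^δ is a product of local factors (a + 1)/p^(aδ). These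
are at most 1 once p^δ ≥ 2, and for each of the finitely many smaller p Bernoulli's inequality
bounds them by b⁻¹. -/
theorem exists_card_divisors_le_rpow {δ : ℝ} (hδ : 0 < δ) :
    ∃ C : ℝ, 1 ≤ C ∧ ∀ n : ℕ, (n.divisors.card : ℝ) ≤ C * (n : ℝ) ^ δ := by
  set b : ℝ := min 1 (δ * Real.log 2) with hb
  have hlog2 : 0 < Real.log 2 := Real.log_pos one_lt_two
  have hb0 : 0 < b := lt_min one_pos (mul_pos hδ hlog2)
  have hb1 : b ≤ 1 := min_le_left _ _
  have hinv : 1 ≤ b⁻¹ := (one_le_inv₀ hb0).2 hb1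
  set K : ℕ := ⌈(2 : ℝ) ^ (δ⁻¹)⌉₊ with hK
  let c : ℕ → ℝ := fun p => if p < K then b⁻¹ else 1
  have hc1 : ∀ p, 1 ≤ c p := fun p => by
    simp only [c]; split_ifs
    · exact hinv
    · exact le_rfl
  have hlocal : ∀ p : ℕ, p.Prime → ∀ a : ℕ, ((a + 1 : ℕ) : ℝ) ≤ c p * ((p : ℝ) ^ a) ^ δ := by
    intro p hp a
    have hp0 : (0 : ℝ) ≤ p := Nat.cast_nonneg p
    have hswap : ((p : ℝ) ^ a) ^ δ = ((p : ℝ) ^ δ) ^ a := by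
      rw [← Real.rpow_natCast, ← Real.rpow_mul hp0, ← Real.rpow_natCast, ← Real.rpow_mul hp0,
        mul_comm]
    rw [hswap]
    simp only [c]
    split_ifs with h
    · have h2 : (2 : ℝ) ^ δ ≤ (p : ℝ) ^ δ :=
        Real.rpow_le_rpow (by norm_num) (by exact_mod_cast hp.two_le) hδ.le
      have h3 : 1 + δ * Real.log 2 ≤ (2 : ℝ) ^ δ := by
        rw [Real.rpow_def_of_pos two_pos, mul_comm]
        linarith [Real.add_one_le_exp (Real.log 2 * δ)]
      have h4 : 1 + b ≤ (p : ℝ) ^ δ := by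
        linarith [min_le_right 1 (δ * Real.log 2)]
      have h5 : 1 + (a : ℝ) * b ≤ ((p : ℝ) ^ δ) ^ a :=
        (one_add_mul_le_pow (by linarith) a).trans (pow_le_pow_left₀ (by linarith) h4 a)
      rw [inv_mul_eq_div, le_div_iff₀ hb0]
      push_cast
      nlinarith
    · rw [one_mul]
      have h2 : (2 : ℝ) ≤ (p : ℝ) ^ δ := by
        have h3 : (2 : ℝ) ^ (δ⁻¹) ≤ p := (Nat.le_ceil _).trans (by exact_mod_cast not_lt.1 h)
        calc (2 : ℝ) = ((2 : ℝ) ^ (δ⁻¹)) ^ δ := by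
              rw [← Real.rpow_mul (by norm_num), inv_mul_cancel₀ hδ.ne', Real.rpow_one]
          _ ≤ (p : ℝ) ^ δ := Real.rpow_le_rpow (by positivity) h3 hδ.le
      calc ((a + 1 : ℕ) : ℝ) ≤ (2 : ℝ) ^ a := by exact_mod_cast Nat.lt_two_pow_self (n := a)
        _ ≤ ((p : ℝ) ^ δ) ^ a := pow_le_pow_left₀ (by norm_num) h2 a
  refine ⟨b⁻¹ ^ K, one_le_pow₀ hinv, fun n => ?_⟩
  rcases eq_or_ne n 0 with rfl | hn
  · simp [Real.zero_rpow hδ.ne']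
  have hn' : (n : ℝ) ^ δ = ∏ p ∈ n.primeFactors, ((p : ℝ) ^ n.factorization p) ^ δ := by
    rw [Real.finsetProd_rpow _ _ fun p _ => by positivity]
    congr 1
    conv_lhs => rw [← Nat.prod_factorization_pow_eq_self hn]
    rw [Finsupp.prod, Nat.support_factorization]
    push_cast
    rfl
  have hcprod : ∏ p ∈ n.primeFactors, c p ≤ b⁻¹ ^ K := by
    calc ∏ p ∈ n.primeFactors, c p = ∏ p ∈ n.primeFactors with p < K, b⁻¹ :=
          (Finset.prod_filter _ _).symm
      _ = b⁻¹ ^ (n.primeFactors.filter fun p => p < K).card := by rw [Finset.prod_const]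
      _ ≤ b⁻¹ ^ K := by
        refine pow_le_pow_right₀ hinv ?_
        have : (n.primeFactors.filter fun p => p < K) ⊆ Finset.range K := fun p hp =>
          Finset.mem_range.2 (Finset.mem_filter.1 hp).2
        simpa using Finset.card_le_card this
  rw [Nat.card_divisors hn, hn', Nat.cast_prod]
  calc ∏ p ∈ n.primeFactors, ((n.factorization p + 1 : ℕ) : ℝ)
      ≤ ∏ p ∈ n.primeFactors, (c p * ((p : ℝ) ^ n.factorization p) ^ δ) :=
        Finset.prod_le_prod (fun _ _ => by positivity)
          fun p hp => hlocal p (Nat.prime_of_mem_primeFactors hp) _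
    _ = (∏ p ∈ n.primeFactors, c p) * ∏ p ∈ n.primeFactors, ((p : ℝ) ^ n.factorization p) ^ δ :=
        Finset.prod_mul_distrib
    _ ≤ _ := mul_le_mul_of_nonneg_right hcprod (Finset.prod_nonneg fun _ _ => by positivity)

-- Chebyshev's estimates give θ(4z) − θ(z) ≥ z for large z. The lower constant log 2 and the upper
-- constant log 4 differ by a factor 2, so the interval must be longer than (z, 2z]; the remaining
-- logarithm is absorbed by z^δ.
open Filter in
theorem eventually_rpow_le_card_primes {δ : ℝ} (hδ : 0 < δ) :
    ∀ᶠ z : ℕ in atTop,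
      (z : ℝ) ^ (1 - δ) ≤ ((Finset.Ioc z (4 * z)).filter Nat.Prime).card := by
  have htend : Tendsto (fun z : ℕ => (4 * z : ℝ)) atTop atTop :=
    tendsto_natCast_atTop_atTop.const_mul_atTop (by norm_num)
  have h1 : ∀ᶠ z : ℕ in atTop, Real.log (4 * z) ≤ 1 / 80 * (4 * z : ℝ) ^ (1 / 2 : ℝ) := by
    have := ((isLittleO_log_rpow_atTop (r := 1 / 2) (by norm_num)).def
      (c := 1 / 80) (by norm_num))
    filter_upwards [htend.eventually this] with z hz
    rw [Real.norm_of_nonneg (Real.rpow_nonneg (by positivity) _)] at hz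
    exact (le_abs_self _).trans hz
  have h2 : ∀ᶠ z : ℕ in atTop, Real.log (4 * z) ≤ (z : ℝ) ^ δ := by
    have hc : (0 : ℝ) < (4 ^ δ)⁻¹ := by positivity
    have := (isLittleO_log_rpow_atTop hδ).def hc
    filter_upwards [htend.eventually this] with z hz
    rw [Real.norm_of_nonneg (Real.rpow_nonneg (by positivity) _),
      Real.mul_rpow (by norm_num) (Nat.cast_nonneg z), ← mul_assoc,
      inv_mul_cancel₀ (by positivity), one_mul] at hz
    exact (le_abs_self _).trans hz
  filter_upwards [h1, h2, eventually_ge_atTop 100] with z hz1 hz2 hz3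
  have hz0 : (100 : ℝ) ≤ z := by exact_mod_cast hz3
  set P := (Finset.Ioc z (4 * z)).filter Nat.Prime with hP
  have hlog0 : 0 < Real.log (4 * z) := Real.log_pos (by linarith)
  have hdiff : Chebyshev.theta ((4 * z : ℕ) : ℝ) - Chebyshev.theta z ≤
      P.card * Real.log (4 * z) := by
    rw [Chebyshev.theta, Chebyshev.theta, Nat.floor_natCast, Nat.floor_natCast]
    have hsplit : (Finset.Ioc 0 (4 * z)).filter Nat.Prime =
        (Finset.Ioc 0 z).filter Nat.Prime ∪ P := by
      rw [hP, ← Finset.filter_union, Finset.Ioc_union_Ioc_eq_Ioc (Nat.zero_le _) (by omega)]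
    have hdisj : Disjoint ((Finset.Ioc 0 z).filter Nat.Prime) P := by
      rw [hP]
      refine Finset.disjoint_filter_filter (Finset.disjoint_left.2 fun x hx hx' => ?_)
      rw [Finset.mem_Ioc] at hx hx'
      omega
    rw [hsplit, Finset.sum_union hdisj, add_sub_cancel_left, ← nsmul_eq_mul]
    refine Finset.sum_le_card_nsmul _ _ _ fun p hp => ?_
    obtain ⟨hp1, hp2⟩ := Finset.mem_filter.1 hp
    have hp3 := (Finset.mem_Ioc.1 hp1).2
    exact Real.log_le_log (by exact_mod_cast hp2.pos) (by exact_mod_cast hp3)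
  have hge := Chebyshev.theta_ge (4 * z)
  have hle := Chebyshev.theta_le_log4_mul_x (x := (z : ℝ)) (by positivity)
  have hlog4 : Real.log 4 = 2 * Real.log 2 := by
    rw [show (4 : ℝ) = 2 ^ 2 by norm_num, Real.log_pow]; norm_num
  rw [hlog4] at hle
  push_cast at hge hdiff
  have hs : √(4 * z : ℝ) * √(4 * z : ℝ) = 4 * z := Real.mul_self_sqrt (by positivity)
  have hs1 : (1 : ℝ) ≤ √(4 * z : ℝ) := Real.one_le_sqrt.2 (by linarith)
  rw [← Real.sqrt_eq_rpow] at hz1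
  have hlog1 : Real.log (4 * z + 1) ≤ 1 + 1 / 80 * √(4 * z : ℝ) := by
    have : Real.log (4 * z + 1) ≤ Real.log (2 * (4 * z)) :=
      Real.log_le_log (by positivity) (by linarith)
    rw [Real.log_mul (by norm_num) (by positivity)] at this
    have := Real.log_two_lt_d9
    linarith
  have hsl : 2 * √(4 * z : ℝ) * Real.log (4 * z) ≤ z / 10 := by
    have : 2 * √(4 * z : ℝ) * Real.log (4 * z) ≤ 2 * √(4 * z : ℝ) * (1 / 80 * √(4 * z : ℝ)) :=
      mul_le_mul_of_nonneg_left hz1 (by positivity)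
    nlinarith
  have hsz : √(4 * z : ℝ) ≤ 4 * z := by nlinarith
  have hmain : (z : ℝ) ≤ P.card * Real.log (4 * z) := by
    have := Real.log_two_gt_d9
    nlinarith
  rw [Real.rpow_sub (by linarith), Real.rpow_one, div_le_iff₀ (by positivity)]
  exact hmain.trans (mul_le_mul_of_nonneg_left hz2 (Nat.cast_nonneg _))

/-! ### Choosing m and the residue class of n -/

/-- Many products of two primes from `B` that are squares modulo `t` and whose factors agree
modulo `W`. -/
theorem exists_many_square_products {B : Finset ℕ} (hB : ∀ p ∈ B, p.Prime) (hB2 : 2 ≤ B.card)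
    {t W : ℕ} (ht : t.Prime) (hW : 0 < W) :
    ∃ M : Finset ℕ, B.card ^ 2 ≤ 24 * W * M.card ∧ ∀ m ∈ M, ∃ p₁ ∈ B, ∃ p₂ ∈ B,
      m = p₁ * p₂ ∧ p₁ ≡ p₂ [MOD W] ∧ t ≠ p₁ ∧ t ≠ p₂ ∧ IsSquare ((p₁ * p₂ : ℕ) : ZMod t) := by
  classical
  have : Fact t.Prime := ⟨ht⟩
  set B' := B.erase t with hB'
  -- Equal colours give both p₁ ≡ p₂ modulo W and a product with Legendre symbol 1 at t.
  let col : ℕ → ℕ × ℤ := fun p => (p % W, jacobiSym p t)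
  set R := (B' ×ˢ B').filter fun x => col x.1 = col x.2 with hR
  set M := R.image fun x => x.1 * x.2 with hM
  have hmemB' : ∀ p ∈ B', p ∈ B ∧ t ≠ p := fun p hp =>
    ⟨Finset.mem_of_mem_erase hp, (Finset.ne_of_mem_erase hp).symm⟩
  have hRmem : ∀ x ∈ R, x.1 ∈ B' ∧ x.2 ∈ B' ∧ col x.1 = col x.2 := by
    intro x hx
    obtain ⟨h1, h2⟩ := Finset.mem_filter.1 hx
    exact ⟨(Finset.mem_product.1 h1).1, (Finset.mem_product.1 h1).2, h2⟩
  have hcolcard : (B'.image col).card ≤ 3 * W := by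
    have hsub : B'.image col ⊆ Finset.range W ×ˢ ({0, 1, -1} : Finset ℤ) := by
      intro y hy
      obtain ⟨p, -, rfl⟩ := Finset.mem_image.1 hy
      rw [Finset.mem_product, Finset.mem_range]
      refine ⟨Nat.mod_lt _ hW, ?_⟩
      simpa using jacobiSym.trichotomy (p : ℤ) t
    refine (Finset.card_le_card hsub).trans ?_
    rw [Finset.card_product, Finset.card_range, mul_comm]
    exact Nat.mul_le_mul_right _ Finset.card_le_three
  have hRM : R.card ≤ 2 * M.card := by
    refine Finset.card_le_mul_card_image R 2 fun m hm => ?_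
    obtain ⟨⟨a, b⟩, hab, rfl⟩ := Finset.mem_image.1 hm
    have ha := hB _ (hmemB' _ (hRmem _ hab).1).1
    have hb := hB _ (hmemB' _ (hRmem _ hab).2.1).1
    refine le_trans (Finset.card_le_card_of_injOn (fun x => x.1) ?_ ?_)
      (Finset.card_le_two (a := a) (b := b))
    · rintro ⟨u, v⟩ hx
      simp only [Finset.coe_filter, Set.mem_ofPred_eq] at hx
      have hu := hB _ (hmemB' _ (hRmem _ hx.1).1).1
      simp only at ha hb hu
      have hdvd : u ∣ a * b := hx.2 ▸ dvd_mul_right _ _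
      simp only [Finset.coe_insert, Finset.coe_singleton, Set.mem_insert_iff,
        Set.mem_singleton_iff]
      exact (hu.dvd_mul.1 hdvd).imp (Nat.prime_dvd_prime_iff_eq hu ha).1
        (Nat.prime_dvd_prime_iff_eq hu hb).1
    · rintro ⟨u, v⟩ hx ⟨u', v'⟩ hy huv
      simp only [Finset.coe_filter, Set.mem_ofPred_eq] at hx hy huv
      subst huv
      have hu := hB _ (hmemB' _ (hRmem _ hx.1).1).1
      exact Prod.ext rfl (Nat.eq_of_mul_eq_mul_left hu.pos (hx.2.trans hy.2.symm))
  refine ⟨M, ?_, ?_⟩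
  · have h1 := Finset.sq_card_le_card_image_mul_card_pairs B' col
    rw [← hR] at h1
    have h2 : B.card ≤ B'.card + 1 := by
      have := Finset.pred_card_le_card_erase (s := B) (a := t)
      rw [← hB'] at this
      omega
    have h3 : B.card ^ 2 ≤ 4 * B'.card ^ 2 := by nlinarith
    -- 24 = 4 · 3 · 2: discarding t from B, the three symbol values, and the order of the two
    -- factors of m.
    calc B.card ^ 2 ≤ 4 * ((B'.image col).card * R.card) := h3.trans (Nat.mul_le_mul_left 4 h1)
      _ ≤ 4 * (3 * W * (2 * M.card)) := Nat.mul_le_mul_left 4 (Nat.mul_le_mul hcolcard hRM)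
      _ = 24 * W * M.card := by ring
  · intro m hm
    obtain ⟨⟨a, b⟩, hab, rfl⟩ := Finset.mem_image.1 hm
    obtain ⟨h1, h2, h3⟩ := hRmem _ hab
    obtain ⟨ha, hta⟩ := hmemB' _ h1
    obtain ⟨hb, htb⟩ := hmemB' _ h2
    simp only [col, Prod.mk.injEq] at h3
    refine ⟨a, ha, b, hb, rfl, h3.1, hta, htb, ?_⟩
    have hJ : jacobiSym ((a * b : ℕ) : ℤ) t = 1 := by
      push_cast
      rw [jacobiSym.mul_left, ← h3.2]
      have hcop : Int.gcd (a : ℤ) t = 1 := by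
        rw [Int.gcd_natCast_natCast]
        exact (Nat.coprime_primes (hB a ha) ht).2 (Ne.symm hta)
      rcases jacobiSym.eq_one_or_neg_one hcop with h | h <;> simp [h]
    have := ZMod.isSquare_of_jacobiSym_eq_one hJ
    simpa using this

/-- Hensel lifting from t to t²: the root a is simple because t does not divide 2a. -/
theorem exists_sq_dvd_sub_sq {t m : ℕ} (ht : t.Prime) (ht2 : t ≠ 2) (htm : ¬ t ∣ m)
    (hsq : IsSquare (m : ZMod t)) : ∃ r : ℕ, (t : ℤ) ^ 2 ∣ (m : ℤ) - (r : ℤ) ^ 2 := by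
  have : Fact t.Prime := ⟨ht⟩
  have htZ : Prime (t : ℤ) := Nat.prime_iff_prime_int.1 ht
  obtain ⟨b, hb⟩ := hsq
  obtain ⟨a, rfl⟩ := ZMod.natCast_zmod_surjective b
  have h1 : (t : ℤ) ∣ (m : ℤ) - (a : ℤ) ^ 2 := by
    rw [← ZMod.intCast_zmod_eq_zero_iff_dvd]
    push_cast
    rw [hb, sq, sub_self]
  obtain ⟨e, he⟩ := h1
  have h2 : IsCoprime (t : ℤ) (2 * a) := by
    rw [htZ.coprime_iff_not_dvd]
    intro h
    rcases htZ.dvd_or_dvd h with h | h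
    · exact ht2 ((Nat.prime_dvd_prime_iff_eq ht Nat.prime_two).1 (by exact_mod_cast h))
    · apply htm
      have h3 : (t : ℤ) ∣ m := by
        have := (dvd_mul_right (t : ℤ) e).add (h.trans (dvd_pow_self (a : ℤ) two_ne_zero))
        rwa [← he, sub_add_cancel] at this
      exact_mod_cast h3
  obtain ⟨u, v, huv⟩ := h2
  -- the Newton step
  set s : ℤ := a + t * (v * e) with hs
  have h3 : (t : ℤ) ^ 2 ∣ (m : ℤ) - s ^ 2 := by
    refine ⟨u * e - (v * e) ^ 2, ?_⟩
    rw [hs]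
    linear_combination he - (t : ℤ) * e * huv
  refine ⟨s.natAbs, ?_⟩
  rwa [Int.natCast_natAbs, sq_abs]

/-- The residue class for `n`: it makes `m ^ g - n ^ 2` divisible by `t ^ 2`, odd, and divisible
exactly once by each prime factor of `P`. -/
theorem exists_residue {P t p₁ p₂ : ℕ} (g : ℕ) (hP : Odd P) (hPsq : Squarefree P)
    (ht : t.Prime) (ht2 : t ≠ 2) (htP : Nat.Coprime t (2 * P ^ 2))
    (hp₁ : Nat.Coprime p₁ (2 * P ^ 2)) (hp₁₂ : p₁ ≡ p₂ [MOD 2 * P ^ 2])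
    (htm : ¬ t ∣ p₁ * p₂) (hsq : IsSquare ((p₁ * p₂ : ℕ) : ZMod t)) :
    ∃ r : ℕ, (t : ℤ) ^ 2 ∣ ((p₁ * p₂ : ℕ) : ℤ) ^ g - (r : ℤ) ^ 2 ∧
      ∀ n : ℕ, n ≡ r [MOD 2 * P ^ 2] → Even n ∧
        (P : ℤ) ∣ ((p₁ * p₂ : ℕ) : ℤ) ^ g - (n : ℤ) ^ 2 ∧
        ∀ q : ℕ, q.Prime → q ∣ 2 * P ^ 2 →
          ¬ (q : ℤ) ^ 2 ∣ ((p₁ * p₂ : ℕ) : ℤ) ^ g - (n : ℤ) ^ 2 := by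
  obtain ⟨a, ha⟩ := exists_sq_dvd_sub_sq ht ht2 htm hsq
  -- Modulo t², a^g is a square root of m^g. Modulo W one has m ≡ p₁², so n ≡ p₁^g(P + 1) gives m^g
  -- − n² ≡ −p₁^(2g)P(P + 2), where P + 2 is prime to the odd number P. As P + 1 is even, n is even.
  obtain ⟨r, hr1, hr2⟩ := Nat.chineseRemainder (htP.pow_left 2) (a ^ g) (p₁ ^ g * (P + 1))
  set W := 2 * P ^ 2 with hW
  refine ⟨r, ?_, fun n hn => ?_⟩
  · have h1 := ha.trans (sub_dvd_pow_sub_pow ((p₁ * p₂ : ℕ) : ℤ) ((a : ℤ) ^ 2) g)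
    have h2 : (t : ℤ) ^ 2 ∣ (a : ℤ) ^ g - r := by
      have := Nat.modEq_iff_dvd.1 hr1
      push_cast at this
      exact this
    have h3 := h1.add (h2.mul_right ((a : ℤ) ^ g + r))
    rwa [show ((p₁ * p₂ : ℕ) : ℤ) ^ g - ((a : ℤ) ^ 2) ^ g + ((a : ℤ) ^ g - r) * ((a : ℤ) ^ g + r)
      = ((p₁ * p₂ : ℕ) : ℤ) ^ g - (r : ℤ) ^ 2 by ring] at h3
  have hn' : n ≡ p₁ ^ g * (P + 1) [MOD W] := hn.trans hr2
  have hodd1 : Odd p₁ := Nat.coprime_two_right.1 (hp₁.coprime_dvd_right (dvd_mul_right _ _))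
  have h2W : 2 ∣ W := dvd_mul_right _ _
  have hodd2 : Odd p₂ := by
    have := hp₁₂.of_dvd h2W
    rw [Nat.odd_iff] at hodd1 ⊢
    rw [← this]; exact hodd1
  have heven : Even n := by
    have h1 : n ≡ p₁ ^ g * (P + 1) [MOD 2] := hn'.of_dvd h2W
    have h2 : Even (p₁ ^ g * (P + 1)) := (hP.add_one).mul_left _
    rw [Nat.even_iff] at h2 ⊢
    rw [h1]; exact h2
  -- the value of the form modulo `W`
  have hval : (W : ℤ) ∣ (((p₁ * p₂ : ℕ) : ℤ) ^ g - (n : ℤ) ^ 2) +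
      ((p₁ : ℤ) ^ g) ^ 2 * (P * (P + 2)) := by
    have h1 : (W : ℤ) ∣ (p₂ : ℤ) - p₁ := Nat.modEq_iff_dvd.1 hp₁₂
    have h2 := h1.trans (sub_dvd_pow_sub_pow (p₂ : ℤ) p₁ g)
    have h3 : (W : ℤ) ∣ (p₁ : ℤ) ^ g * (P + 1) - n := by
      have := Nat.modEq_iff_dvd.1 hn'
      push_cast at this
      exact this
    have h4 := (h2.mul_left ((p₁ : ℤ) ^ g)).add (h3.mul_right ((p₁ : ℤ) ^ g * (P + 1) + n))
    push_cast
    rwa [show (p₁ : ℤ) ^ g * ((p₂ : ℤ) ^ g - (p₁ : ℤ) ^ g) +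
      ((p₁ : ℤ) ^ g * (P + 1) - n) * ((p₁ : ℤ) ^ g * (P + 1) + n) =
      ((p₁ : ℤ) * p₂) ^ g - (n : ℤ) ^ 2 + ((p₁ : ℤ) ^ g) ^ 2 * (P * (P + 2)) by ring] at h4
  have hPW : (P : ℤ) ∣ W := by
    rw [hW]; push_cast
    exact (dvd_pow_self (P : ℤ) two_ne_zero).mul_left 2
  refine ⟨heven, ?_, fun q hq hqW hqd => ?_⟩
  · have h1 : (P : ℤ) ∣ ((p₁ : ℤ) ^ g) ^ 2 * (P * (P + 2)) := (dvd_mul_right _ _).mul_left _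
    exact (dvd_add_left h1).1 (hPW.trans hval)
  by_cases hq2 : q = 2
  · subst hq2
    have h1 : Odd (((p₁ * p₂ : ℕ) : ℤ) ^ g - (n : ℤ) ^ 2) := by
      have h2 : Odd (((p₁ * p₂ : ℕ) : ℤ) ^ g) := by exact_mod_cast (hodd1.mul hodd2).pow
      have h3 : Even ((n : ℤ) ^ 2) := by
        have := heven.pow_of_ne_zero (two_ne_zero)
        exact_mod_cast this
      exact h2.sub_even h3
    have h4 : (2 : ℤ) ∣ ((p₁ * p₂ : ℕ) : ℤ) ^ g - (n : ℤ) ^ 2 :=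
      (dvd_pow_self (2 : ℤ) two_ne_zero).trans (by exact_mod_cast hqd)
    exact (Int.not_even_iff_odd.2 h1) (even_iff_two_dvd.2 h4)
  · have hqP : q ∣ P := by
      rcases hq.dvd_mul.1 hqW with h | h
      · exact absurd ((Nat.prime_dvd_prime_iff_eq hq Nat.prime_two).1 h) hq2
      · exact hq.dvd_of_dvd_pow h
    have hqW2 : (q : ℤ) ^ 2 ∣ W := by
      have : q ^ 2 ∣ W := (pow_dvd_pow_of_dvd hqP 2).mul_left 2
      exact_mod_cast this
    have h1 : (q : ℤ) ^ 2 ∣ ((p₁ : ℤ) ^ g) ^ 2 * (P * (P + 2)) :=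
      (dvd_add_right hqd).1 (hqW2.trans hval)
    have h2 : q ^ 2 ∣ (p₁ ^ g) ^ 2 * (P + 2) * P := by
      have : q ^ 2 ∣ (p₁ ^ g) ^ 2 * (P * (P + 2)) := by exact_mod_cast h1
      rwa [show (p₁ ^ g) ^ 2 * (P + 2) * P = (p₁ ^ g) ^ 2 * (P * (P + 2)) by ring]
    have h3 : Nat.Coprime q ((p₁ ^ g) ^ 2 * (P + 2)) := by
      refine Nat.Coprime.mul_right ?_ ?_
      · exact (((hp₁.coprime_dvd_right hqW).symm).pow_right g).pow_right 2
      · rw [Nat.Prime.coprime_iff_not_dvd hq]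
        intro h
        have : q ∣ 2 := (Nat.dvd_add_right hqP).1 h
        exact hq2 ((Nat.prime_dvd_prime_iff_eq hq Nat.prime_two).1 this)
    have h4 : q * q ∣ P := by
      rw [← sq]
      exact (h3.pow_left 2).dvd_of_dvd_mul_left h2
    exact hq.one_lt.ne' (Nat.isUnit_iff.1 (hPsq q h4))

/-- A positive proportion of the `n < N` in a residue class give a representation with
`(m ^ g - n ^ 2) / t ^ 2` divisible by `P` and free of squares of primes up to `Q`. -/
theorem exists_many_sieved {P t p₁ p₂ q₀ Q N : ℕ} (g : ℕ) (hP : Odd P) (hPsq : Squarefree P)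
    (hPq₀ : ∀ q : ℕ, q.Prime → q ≤ q₀ → q ∣ 2 * P ^ 2) (hq₀ : 16 ≤ q₀)
    (ht : t.Prime) (htW : 2 * P ^ 2 < t) (hp₁ : p₁.Prime) (hp₁W : 2 * P ^ 2 < p₁)
    (hp₂ : p₂.Prime)
    (hp₁Q : p₁ ≤ Q) (hp₂Q : p₂ ≤ Q) (hp₁16 : 16 ≤ p₁) (hp₂16 : 16 ≤ p₂)
    (hp₁₂ : p₁ ≡ p₂ [MOD 2 * P ^ 2]) (ht₁ : t ≠ p₁) (ht₂ : t ≠ p₂)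
    (hsq : IsSquare ((p₁ * p₂ : ℕ) : ZMod t)) (hg : 2 ≤ g)
    (hN : 8 * (Q : ℝ) + 12 ≤ (N : ℝ) / (2 * P ^ 2 * t ^ 2 : ℕ)) :
    ∃ G : Finset ℕ, (N : ℝ) / (2 * P ^ 2 * t ^ 2 : ℕ) ≤ 2 * (G.card : ℝ) ∧ ∀ n ∈ G, n < N ∧
      Even n ∧ (P : ℤ) ∣ ((p₁ * p₂ : ℕ) : ℤ) ^ g - (n : ℤ) ^ 2 ∧
      (t : ℤ) ^ 2 ∣ ((p₁ * p₂ : ℕ) : ℤ) ^ g - (n : ℤ) ^ 2 ∧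
      (∀ q : ℕ, q.Prime → q ≤ Q → ¬ ((q : ℤ) * t) ^ 2 ∣ ((p₁ * p₂ : ℕ) : ℤ) ^ g - (n : ℤ) ^ 2) ∧
      Nat.Coprime n (p₁ * p₂) := by
  classical
  have hP0 : 0 < P := hP.pos
  have hW0 : 0 < 2 * P ^ 2 := by positivity
  have hcopW : ∀ q : ℕ, q.Prime → 2 * P ^ 2 < q → Nat.Coprime q (2 * P ^ 2) := fun q hq h =>
    (Nat.Prime.coprime_iff_not_dvd hq).2 fun hd => (Nat.le_of_dvd hW0 hd).not_gt h
  have hmem : ∀ q : ℕ, q.Prime → q ∣ p₁ * p₂ → q = p₁ ∨ q = p₂ := fun q hq h =>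
    (hq.dvd_mul.1 h).imp (Nat.prime_dvd_prime_iff_eq hq hp₁).1
      (Nat.prime_dvd_prime_iff_eq hq hp₂).1
  have htm : ¬ t ∣ p₁ * p₂ := fun h => by
    rcases hmem t ht h with h | h
    · exact ht₁ h
    · exact ht₂ h
  have hdvdZ : ∀ q : ℕ, q.Prime → (q : ℤ) ∣ ((p₁ * p₂ : ℕ) : ℤ) ^ g → q ∣ p₁ * p₂ :=
    fun q hq h => by
      have : q ∣ (p₁ * p₂) ^ g := by exact_mod_cast h
      exact hq.dvd_of_dvd_pow this
  have ht2 : t ≠ 2 := by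
    have : 1 ≤ P ^ 2 := Nat.one_le_pow _ _ hP0
    omega
  obtain ⟨r, hr, hrn⟩ := exists_residue g hP hPsq ht ht2 (hcopW t ht htW) (hcopW p₁ hp₁ hp₁W)
    hp₁₂ htm hsq
  have hmain := le_two_mul_card_sieved (W := 2 * P ^ 2) (t := t) (N := N) (Q := Q) (r := r)
    (q₀ := q₀) (p₁ := p₁) (p₂ := p₂) (c := ((p₁ * p₂ : ℕ) : ℤ) ^ g) (dvd_mul_right _ _) hW0 ht
    (hcopW t ht htW) hr (fun h => htm (hdvdZ t ht h)) hPq₀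
    (fun q hq hqW n hn => (hrn n hn).2.2 q hq hqW)
    (fun q hq h => hmem q hq (hdvdZ q hq h)) hp₁16 hp₂16 hq₀ hN
  refine ⟨_, hmain, fun n hn => ?_⟩
  obtain ⟨hnN, hnr, hnq⟩ := Finset.mem_filter.1 hn
  obtain ⟨h1, h2, -⟩ := hrn n (hnr.of_mul_right _)
  have ht2n : (t : ℤ) ^ 2 ∣ ((p₁ * p₂ : ℕ) : ℤ) ^ g - (n : ℤ) ^ 2 := by
    have h3 : (t : ℤ) ^ 2 ∣ (r : ℤ) - n := by
      have := Nat.modEq_iff_dvd.1 (hnr.of_mul_left (2 * P ^ 2))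
      push_cast at this
      exact this
    have h4 := hr.add (h3.mul_right ((r : ℤ) + n))
    rwa [show ((p₁ * p₂ : ℕ) : ℤ) ^ g - (r : ℤ) ^ 2 + ((r : ℤ) - n) * (r + n) =
      ((p₁ * p₂ : ℕ) : ℤ) ^ g - (n : ℤ) ^ 2 by ring] at h4
  refine ⟨Finset.mem_range.1 hnN, h1, h2, ht2n, hnq, ?_⟩
  -- A common prime of n and m is p₁ or p₂, hence at most Q and different from t. It would make
  -- (qt)² divide m^g − n², which the sieve excludes.
  refine Nat.coprime_of_dvd fun q hq hqn hqm => ?_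
  have hqQ : q ≤ Q := by rcases hmem q hq hqm with h | h <;> rw [h] <;> assumption
  refine hnq q hq hqQ ?_
  have h5 : (q : ℤ) ^ 2 ∣ ((p₁ * p₂ : ℕ) : ℤ) ^ g - (n : ℤ) ^ 2 := by
    refine Dvd.dvd.sub ?_ (pow_dvd_pow_of_dvd (by exact_mod_cast hqn) 2)
    exact (pow_dvd_pow_of_dvd (by exact_mod_cast hqm) 2).trans (pow_dvd_pow _ hg)
  have hqt : q ≠ t := by rintro rfl; exact htm hqm
  have h6 : IsCoprime ((q : ℤ) ^ 2) ((t : ℤ) ^ 2) :=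
    (Nat.isCoprime_iff_coprime.2 ((Nat.coprime_primes hq ht).2 hqt)).pow
  rw [mul_pow]
  exact h6.mul_dvd h5 ht2n

/-! ### Sizes of the parameters and supply of triples -/

/-- With U = Y^(2k) and V = Y^(4k+12), one has U ≤ t² ≤ 16U, 64UV ≤ m^g ≤ 64^g UV and n² ≤ UV, so d
has size V. Moreover V³ = Y^(6k+24)UV leaves ample room for the comparison of m^g with d³. -/
theorem discriminant_bounds {k Y t m n d : ℕ} (hk : 1 ≤ k) (hY : 64 ≤ Y) (ht : Y ^ k < t)
    (ht' : t ≤ 4 * Y ^ k) (hm : 4 * Y ^ 6 ≤ m) (hm' : m ≤ 64 * Y ^ 6) (hn : n < Y ^ (3 * k + 6))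
    (heq : m ^ (k + 2) = n ^ 2 + t ^ 2 * d) :
    3 * Y ^ (4 * k + 12) ≤ d ∧ d ≤ 64 ^ (k + 2) * Y ^ (4 * k + 12) ∧
      64 * m ^ (k + 2) < d ^ 3 := by
  have hY0 : 0 < Y := by omega
  have hexp : (Y ^ 6) ^ (k + 2) = Y ^ (2 * k) * Y ^ (4 * k + 12) := by
    rw [← pow_mul, ← pow_add]; congr 1; ring
  set V := Y ^ (4 * k + 12) with hV
  set U := Y ^ (2 * k) with hU
  have hU0 : 0 < U := by positivity
  have hV0 : 0 < V := by positivity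
  have hmup : m ^ (k + 2) ≤ 64 ^ (k + 2) * (U * V) := by
    rw [← hexp, ← mul_pow]
    exact Nat.pow_le_pow_left hm' _
  have hmlow : 64 * (U * V) ≤ m ^ (k + 2) := by
    have h1 : (4 * Y ^ 6) ^ (k + 2) ≤ m ^ (k + 2) := Nat.pow_le_pow_left hm _
    rw [mul_pow, hexp] at h1
    have h2 : 4 ^ 3 ≤ 4 ^ (k + 2) := Nat.pow_le_pow_right (by norm_num) (by omega)
    exact (Nat.mul_le_mul_right (U * V) h2).trans h1
  have hn2 : n ^ 2 ≤ U * V := by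
    have h1 : n ^ 2 ≤ (Y ^ (3 * k + 6)) ^ 2 := Nat.pow_le_pow_left hn.le 2
    have h2 : (Y ^ (3 * k + 6)) ^ 2 = U * V := by
      rw [hU, hV, ← pow_mul, ← pow_add]; congr 1; ring
    omega
  have ht2 : t ^ 2 ≤ 16 * U := by
    have h1 : t ^ 2 ≤ (4 * Y ^ k) ^ 2 := Nat.pow_le_pow_left ht' 2
    have h2 : (4 * Y ^ k) ^ 2 = 16 * U := by
      rw [mul_pow, ← pow_mul, mul_comm k 2]; norm_num [hU]
    omega
  have ht2' : U ≤ t ^ 2 := by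
    have h1 : (Y ^ k) ^ 2 ≤ t ^ 2 := Nat.pow_le_pow_left ht.le 2
    have h2 : (Y ^ k) ^ 2 = U := by rw [← pow_mul, mul_comm k 2]
    omega
  have hlow : 3 * V ≤ d := by
    have h1 : 63 * (U * V) ≤ 16 * U * d := by
      have := Nat.mul_le_mul_right d ht2
      omega
    have h2 : U * (63 * V) ≤ U * (16 * d) := by linarith
    have := Nat.le_of_mul_le_mul_left h2 hU0
    omega
  refine ⟨hlow, ?_, ?_⟩
  · have h1 : U * d ≤ U * (64 ^ (k + 2) * V) := by
      calc U * d ≤ t ^ 2 * d := Nat.mul_le_mul_right d ht2'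
        _ ≤ m ^ (k + 2) := by omega
        _ ≤ 64 ^ (k + 2) * (U * V) := hmup
        _ = U * (64 ^ (k + 2) * V) := by ring
    exact Nat.le_of_mul_le_mul_left h1 hU0
  · have h1 : V ^ 3 ≤ d ^ 3 := Nat.pow_le_pow_left (by omega) 3
    have h2 : V ^ 3 = Y ^ (6 * k + 24) * (U * V) := by
      rw [hU, hV, ← pow_mul, ← pow_add, ← pow_add]; congr 1; ring
    have h3 : 64 * 64 ^ (k + 2) < Y ^ (6 * k + 24) := by
      calc 64 * 64 ^ (k + 2) = 64 ^ (k + 3) := by ring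
        _ < 64 ^ (6 * k + 24) := Nat.pow_lt_pow_right (by norm_num) (by omega)
        _ ≤ Y ^ (6 * k + 24) := Nat.pow_le_pow_left hY _
    calc 64 * m ^ (k + 2) ≤ 64 * (64 ^ (k + 2) * (U * V)) := Nat.mul_le_mul_left _ hmup
      _ = 64 * 64 ^ (k + 2) * (U * V) := by ring
      _ < Y ^ (6 * k + 24) * (U * V) := Nat.mul_lt_mul_of_pos_right h3 (by positivity)
      _ = V ^ 3 := h2.symm
      _ ≤ d ^ 3 := h1

/-- The primes from which `t` and the factors of `m` are taken. -/
def primesBlock (z : ℕ) : Finset ℕ := (Finset.Ioc z (4 * z)).filter Nat.Prime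

theorem mem_primesBlock {z p : ℕ} : p ∈ primesBlock z ↔ (z < p ∧ p ≤ 4 * z) ∧ p.Prime := by
  rw [primesBlock, Finset.mem_filter, Finset.mem_Ioc]

theorem card_primesBlock_le (z : ℕ) : (primesBlock z).card ≤ 3 * z := by
  refine (Finset.card_filter_le _ _).trans ?_
  rw [Nat.card_Ioc]
  omega

/-- The integers `m = p₁ p₂` with both factors in `primesBlock (2 Y ^ 3)`. -/
def semiprimes (Y : ℕ) : Finset ℕ :=
  (primesBlock (2 * Y ^ 3) ×ˢ primesBlock (2 * Y ^ 3)).image fun x => x.1 * x.2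

theorem mem_semiprimes {Y m : ℕ} : m ∈ semiprimes Y ↔
    ∃ p₁ ∈ primesBlock (2 * Y ^ 3), ∃ p₂ ∈ primesBlock (2 * Y ^ 3), p₁ * p₂ = m := by
  simp only [semiprimes, Finset.mem_image, Finset.mem_product, Prod.exists]
  constructor
  · rintro ⟨a, b, ⟨ha, hb⟩, h⟩
    exact ⟨a, ha, b, hb, h⟩
  · rintro ⟨a, ha, b, hb, h⟩
    exact ⟨a, b, ⟨ha, hb⟩, h⟩

theorem card_semiprimes_le (Y : ℕ) : (semiprimes Y).card ≤ 36 * Y ^ 6 := by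
  have h := card_primesBlock_le (2 * Y ^ 3)
  calc (semiprimes Y).card ≤ (primesBlock (2 * Y ^ 3) ×ˢ primesBlock (2 * Y ^ 3)).card :=
        Finset.card_image_le
    _ = (primesBlock (2 * Y ^ 3)).card * (primesBlock (2 * Y ^ 3)).card := Finset.card_product _ _
    _ ≤ (3 * (2 * Y ^ 3)) * (3 * (2 * Y ^ 3)) := Nat.mul_le_mul h h
    _ = 36 * Y ^ 6 := by ring

theorem bounds_of_mem_semiprimes {Y m : ℕ} (hm : m ∈ semiprimes Y) :
    4 * Y ^ 6 ≤ m ∧ m ≤ 64 * Y ^ 6 := by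
  obtain ⟨a, ha, b, hb, rfl⟩ := mem_semiprimes.1 hm
  obtain ⟨⟨ha1, ha2⟩, -⟩ := mem_primesBlock.1 ha
  obtain ⟨⟨hb1, hb2⟩, -⟩ := mem_primesBlock.1 hb
  constructor
  · calc 4 * Y ^ 6 = (2 * Y ^ 3) * (2 * Y ^ 3) := by ring
      _ ≤ a * b := Nat.mul_le_mul ha1.le hb1.le
  · calc a * b ≤ (4 * (2 * Y ^ 3)) * (4 * (2 * Y ^ 3)) := Nat.mul_le_mul ha2 hb2
      _ = 64 * Y ^ 6 := by ring

theorem odd_and_card_divisors_of_mem_semiprimes {Y m : ℕ} (hY : 1 ≤ Y) (hm : m ∈ semiprimes Y)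
    (g : ℕ) : Odd m ∧ (m ^ g).divisors.card ≤ (g + 1) ^ 2 := by
  obtain ⟨a, ha, b, hb, rfl⟩ := mem_semiprimes.1 hm
  obtain ⟨⟨ha1, -⟩, ha⟩ := mem_primesBlock.1 ha
  obtain ⟨⟨hb1, -⟩, hb⟩ := mem_primesBlock.1 hb
  have h1 : 1 ≤ Y ^ 3 := Nat.one_le_pow _ _ hY
  exact ⟨(ha.odd_of_ne_two (by omega)).mul (hb.odd_of_ne_two (by omega)),
    card_divisors_semiprime_pow_le ha hb g⟩

/-- The properties of the triples `(t, m, n)` that survive the sieve by primes up to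
`Y ^ (k + 4)`. -/
structure IsSievedTriple (k P Y t m n : ℕ) : Prop where
  mem_t : t ∈ primesBlock (Y ^ k)
  mem_m : m ∈ semiprimes Y
  lt : n < Y ^ (3 * k + 6)
  even : Even n
  dvd : (P : ℤ) ∣ (m : ℤ) ^ (k + 2) - (n : ℤ) ^ 2
  sq_dvd : (t : ℤ) ^ 2 ∣ (m : ℤ) ^ (k + 2) - (n : ℤ) ^ 2
  free : ∀ q : ℕ, q.Prime → q ≤ Y ^ (k + 4) →
    ¬ ((q : ℤ) * t) ^ 2 ∣ (m : ℤ) ^ (k + 2) - (n : ℤ) ^ 2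
  coprime : Nat.Coprime n m
  not_dvd : ¬ t ∣ m

/-- The lower bounds multiply: Y^k/L primes t, Y^6/(48P²L²) values of m for each t, and
Y^(k+6)/(64P²) values of n for each pair. Hence L³ and 3072 = 48 · 64. -/
theorem exists_sieved_triples {k P q₀ Y : ℕ} {L : ℝ} (hk : 1 ≤ k) (hP : Odd P)
    (hPsq : Squarefree P) (hPq₀ : ∀ q : ℕ, q.Prime → q ≤ q₀ → q ∣ 2 * P ^ 2) (hq₀ : 16 ≤ q₀)
    (hL : 1 ≤ L) (hYP : 2 * P ^ 2 < Y) (hY64 : 64 ≤ Y) (hYP' : 640 * P ^ 2 ≤ Y ^ 2)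
    (hT : (Y : ℝ) ^ k ≤ L * (primesBlock (Y ^ k)).card)
    (hB : (Y : ℝ) ^ 3 ≤ L * (primesBlock (2 * Y ^ 3)).card) (hLY : L ≤ Y ^ 2) :
    ∃ S : Finset (ℕ × ℕ × ℕ), (∀ s ∈ S, IsSievedTriple k P Y s.1 s.2.1 s.2.2) ∧
      (Y : ℝ) ^ (2 * k + 12) ≤ 3072 * P ^ 4 * L ^ 3 * S.card := by
  classical
  have hY0 : 0 < Y := by omega
  have hYr : (0 : ℝ) < Y := by exact_mod_cast hY0
  have hP0 : 0 < P := hP.pos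
  have hPr : (0 : ℝ) < P := by exact_mod_cast hP0
  set T := primesBlock (Y ^ k) with hTdef
  set B := primesBlock (2 * Y ^ 3) with hBdef
  have hB2 : 2 ≤ B.card := by
    have h1 : (Y : ℝ) ^ 2 * Y ≤ Y ^ 2 * B.card := by
      calc (Y : ℝ) ^ 2 * Y = Y ^ 3 := by ring
        _ ≤ L * B.card := hB
        _ ≤ Y ^ 2 * B.card := mul_le_mul_of_nonneg_right hLY (Nat.cast_nonneg _)
    have h2 : (Y : ℝ) ≤ B.card := le_of_mul_le_mul_left h1 (by positivity)
    have h3 : Y ≤ B.card := by exact_mod_cast h2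
    omega
  have hTmem : ∀ t ∈ T, Y ≤ Y ^ k ∧ Y ^ k < t ∧ t ≤ 4 * Y ^ k ∧ t.Prime := by
    intro t ht
    obtain ⟨⟨h1, h2⟩, h3⟩ := mem_primesBlock.1 ht
    exact ⟨Nat.le_self_pow (by omega) Y, h1, h2, h3⟩
  have hBmem : ∀ p ∈ B, Y < p ∧ p ≤ Y ^ (k + 4) ∧ p.Prime := by
    intro p hp
    obtain ⟨⟨h1, h2⟩, h3⟩ := mem_primesBlock.1 hp
    have h4 : Y ≤ Y ^ 3 := Nat.le_self_pow (by omega) Y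
    refine ⟨by omega, ?_, h3⟩
    calc p ≤ 8 * Y ^ 3 := by omega
      _ ≤ Y * Y * Y ^ 3 := Nat.mul_le_mul_right _ (by nlinarith)
      _ = Y ^ 5 := by ring
      _ ≤ Y ^ (k + 4) := Nat.pow_le_pow_right hY0 (by omega)
  have hMex : ∀ t : ℕ, ∃ M : Finset ℕ, t ∈ T → (B.card ^ 2 ≤ 24 * (2 * P ^ 2) * M.card ∧
      ∀ m ∈ M, ∃ p₁ ∈ B, ∃ p₂ ∈ B, m = p₁ * p₂ ∧ p₁ ≡ p₂ [MOD 2 * P ^ 2] ∧ t ≠ p₁ ∧ t ≠ p₂ ∧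
        IsSquare ((p₁ * p₂ : ℕ) : ZMod t)) := by
    intro t
    by_cases ht : t ∈ T
    · obtain ⟨M, hM⟩ := exists_many_square_products (B := B) (fun p hp => (hBmem p hp).2.2) hB2
        (hTmem t ht).2.2.2 (W := 2 * P ^ 2) (by positivity)
      exact ⟨M, fun _ => hM⟩
    · exact ⟨∅, fun h => absurd h ht⟩
  choose M hM using hMex
  have hGex : ∀ t m : ℕ, ∃ G : Finset ℕ, t ∈ T → m ∈ M t →
      ((Y : ℝ) ^ (k + 6) ≤ 64 * P ^ 2 * G.card ∧ ∀ n ∈ G, IsSievedTriple k P Y t m n) := by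
    intro t m
    by_cases ht : t ∈ T
    swap
    · exact ⟨∅, fun h => absurd h ht⟩
    by_cases hm : m ∈ M t
    swap
    · exact ⟨∅, fun _ h => absurd h hm⟩
    obtain ⟨p₁, hp₁, p₂, hp₂, rfl, hmod, ht₁, ht₂, hsq⟩ := (hM t ht).2 m hm
    obtain ⟨hYk, htlow, htup, htp⟩ := hTmem t ht
    obtain ⟨h1Y, h1Q, h1p⟩ := hBmem p₁ hp₁
    obtain ⟨h2Y, h2Q, h2p⟩ := hBmem p₂ hp₂
    have hHlow : (Y : ℝ) ^ (k + 6) / (32 * P ^ 2) ≤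
        ((Y ^ (3 * k + 6) : ℕ) : ℝ) / (2 * P ^ 2 * t ^ 2 : ℕ) := by
      have ht0 : (0 : ℝ) < t := by exact_mod_cast htp.pos
      have h1 : (t : ℝ) ≤ 4 * Y ^ k := by exact_mod_cast htup
      have h2 : (t : ℝ) ^ 2 ≤ 16 * Y ^ (2 * k) := by
        calc (t : ℝ) ^ 2 ≤ (4 * Y ^ k) ^ 2 := pow_le_pow_left₀ ht0.le h1 2
          _ = 16 * Y ^ (2 * k) := by ring
      push_cast
      rw [div_le_div_iff₀ (by positivity) (by positivity)]
      calc (Y : ℝ) ^ (k + 6) * (2 * P ^ 2 * t ^ 2)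
          ≤ (Y : ℝ) ^ (k + 6) * (2 * P ^ 2 * (16 * Y ^ (2 * k))) := by gcongr
        _ = (Y : ℝ) ^ (3 * k + 6) * (32 * P ^ 2) := by ring
    -- The sieve needs about Y^(k+6) candidates against primes up to Y^(k+4), a surplus of Y². The
    -- constant 640 is 20 · 32, from 8Q + 12 ≤ 20Q.
    have hNbound : 8 * ((Y ^ (k + 4) : ℕ) : ℝ) + 12 ≤
        ((Y ^ (3 * k + 6) : ℕ) : ℝ) / (2 * P ^ 2 * t ^ 2 : ℕ) := by
      refine le_trans ?_ hHlow
      rw [le_div_iff₀ (by positivity)]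
      push_cast
      have h1 : (1 : ℝ) ≤ (Y : ℝ) ^ (k + 4) := one_le_pow₀ (by exact_mod_cast hY0)
      have h2 : (640 * P ^ 2 : ℝ) ≤ Y ^ 2 := by exact_mod_cast hYP'
      calc (8 * (Y : ℝ) ^ (k + 4) + 12) * (32 * P ^ 2)
          ≤ (20 * (Y : ℝ) ^ (k + 4)) * (32 * P ^ 2) := by gcongr; linarith
        _ = (Y : ℝ) ^ (k + 4) * (640 * P ^ 2) := by ring
        _ ≤ (Y : ℝ) ^ (k + 4) * Y ^ 2 := by gcongr
        _ = (Y : ℝ) ^ (k + 6) := by ring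
    obtain ⟨G, hGcard, hG⟩ := exists_many_sieved (P := P) (t := t) (p₁ := p₁) (p₂ := p₂)
      (q₀ := q₀) (Q := Y ^ (k + 4)) (N := Y ^ (3 * k + 6)) (k + 2) hP hPsq hPq₀ hq₀ htp
      (by omega) h1p (by omega) h2p h1Q h2Q (by omega) (by omega) hmod ht₁ ht₂ hsq (by omega)
      hNbound
    refine ⟨G, fun _ _ => ⟨?_, fun n hn => ?_⟩⟩
    · have h1 := hHlow.trans hGcard
      rw [div_le_iff₀ (by positivity)] at h1
      linarith
    · obtain ⟨h1, h2, h3, h4, h5, h6⟩ := hG n hn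
      refine ⟨ht, mem_semiprimes.2 ⟨p₁, hp₁, p₂, hp₂, rfl⟩, h1, h2, h3, h4, h5, h6, fun h => ?_⟩
      rcases htp.dvd_mul.1 h with h | h
      · exact ht₁ ((Nat.prime_dvd_prime_iff_eq htp h1p).1 h)
      · exact ht₂ ((Nat.prime_dvd_prime_iff_eq htp h2p).1 h)
  choose G hG using hGex
  set U : Finset (Σ _ : (Σ _ : ℕ, ℕ), ℕ) := (T.sigma M).sigma fun x => G x.1 x.2 with hU
  refine ⟨U.image fun z => (z.1.1, z.1.2, z.2), ?_, ?_⟩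
  · intro s hs
    obtain ⟨⟨⟨t, m⟩, n⟩, hz, rfl⟩ := Finset.mem_image.1 hs
    rw [hU, Finset.mem_sigma, Finset.mem_sigma] at hz
    exact (hG t m hz.1.1 hz.1.2).2 n hz.2
  · have hinj : Function.Injective
        fun z : (Σ _ : (Σ _ : ℕ, ℕ), ℕ) => (z.1.1, z.1.2, z.2) := by
      rintro ⟨⟨t, m⟩, n⟩ ⟨⟨t', m'⟩, n'⟩ h
      simp only [Prod.mk.injEq] at h
      obtain ⟨rfl, rfl, rfl⟩ := h
      rfl
    rw [Finset.card_image_of_injective _ hinj, hU, Finset.card_sigma, Finset.sum_sigma]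
    push_cast
    have hg : ∀ t ∈ T, ∀ m ∈ M t, (Y : ℝ) ^ (k + 6) / (64 * P ^ 2) ≤ ((G t m).card : ℝ) := by
      intro t ht m hm
      rw [div_le_iff₀ (by positivity)]
      linarith [(hG t m ht hm).1]
    have hm : ∀ t ∈ T, (Y : ℝ) ^ 6 / (48 * P ^ 2 * L ^ 2) ≤ ((M t).card : ℝ) := by
      intro t ht
      rw [div_le_iff₀ (by positivity)]
      have h1 : ((B.card : ℝ)) ^ 2 ≤ 24 * (2 * P ^ 2) * (M t).card := by
        exact_mod_cast (hM t ht).1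
      calc (Y : ℝ) ^ 6 = (Y ^ 3) ^ 2 := by ring
        _ ≤ (L * B.card) ^ 2 := pow_le_pow_left₀ (by positivity) hB 2
        _ = L ^ 2 * (B.card : ℝ) ^ 2 := by ring
        _ ≤ L ^ 2 * (24 * (2 * P ^ 2) * (M t).card) := by gcongr
        _ = (M t).card * (48 * P ^ 2 * L ^ 2) := by ring
    have hsum : (T.card : ℝ) * ((Y : ℝ) ^ 6 / (48 * P ^ 2 * L ^ 2) *
        ((Y : ℝ) ^ (k + 6) / (64 * P ^ 2))) ≤ ∑ t ∈ T, ∑ m ∈ M t, ((G t m).card : ℝ) := by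
      rw [← nsmul_eq_mul]
      refine Finset.card_nsmul_le_sum _ _ _ fun t ht => ?_
      refine le_trans (mul_le_mul_of_nonneg_right (hm t ht) (by positivity)) ?_
      rw [← nsmul_eq_mul]
      exact Finset.card_nsmul_le_sum _ _ _ fun m hm => hg t ht m hm
    refine le_trans ?_ (mul_le_mul_of_nonneg_left hsum (by positivity))
    have h1 : 3072 * (P : ℝ) ^ 4 * L ^ 3 * (T.card * ((Y : ℝ) ^ 6 / (48 * P ^ 2 * L ^ 2) *
        ((Y : ℝ) ^ (k + 6) / (64 * P ^ 2)))) = (L * T.card) * (Y : ℝ) ^ (k + 12) := by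
      field_simp
      ring
    rw [h1]
    calc (Y : ℝ) ^ (2 * k + 12) = (Y : ℝ) ^ k * (Y : ℝ) ^ (k + 12) := by ring
      _ ≤ _ := by gcongr

namespace IsSievedTriple

variable {k P Y t m n : ℕ}

theorem sq_lt (h : IsSievedTriple k P Y t m n) : n ^ 2 < m ^ (k + 2) := by
  have h1 := (bounds_of_mem_semiprimes h.mem_m).1
  calc n ^ 2 < (Y ^ (3 * k + 6)) ^ 2 := Nat.pow_lt_pow_left h.lt two_ne_zero
    _ = (Y ^ 6) ^ (k + 2) := by rw [← pow_mul, ← pow_mul]; congr 1; ring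
    _ ≤ m ^ (k + 2) := Nat.pow_le_pow_left (by omega) _

theorem prime_t (h : IsSievedTriple k P Y t m n) : t.Prime := (mem_primesBlock.1 h.mem_t).2

theorem pos_n (h : IsSievedTriple k P Y t m n) (hY : 1 ≤ Y) : 0 < n := by
  refine Nat.pos_of_ne_zero ?_
  rintro rfl
  have h1 := (bounds_of_mem_semiprimes h.mem_m).1
  have h2 : 1 ≤ Y ^ 6 := Nat.one_le_pow _ _ hY
  have h3 := (Nat.coprime_zero_left m).1 h.coprime
  omega

theorem eq_of_sq_dvd (h : IsSievedTriple k P Y t m n) {a : ℕ}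
    (ha : (a : ℤ) ^ 2 ∣ (m : ℤ) ^ (k + 2) - (n : ℤ) ^ 2) :
    m ^ (k + 2) = n ^ 2 + a ^ 2 * ((m ^ (k + 2) - n ^ 2) / a ^ 2) := by
  have hlt := h.sq_lt
  have h1 : a ^ 2 ∣ m ^ (k + 2) - n ^ 2 := by
    have : ((a ^ 2 : ℕ) : ℤ) ∣ ((m ^ (k + 2) - n ^ 2 : ℕ) : ℤ) := by
      rw [Nat.cast_sub hlt.le]
      exact_mod_cast ha
    exact_mod_cast this
  rw [Nat.mul_div_cancel' h1]
  omega

end IsSievedTriple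

/-! ### From triples to square-free d -/

/-- The integer `d` attached to a triple `(t, m, n)`. -/
def discriminantOf (k : ℕ) (s : ℕ × ℕ × ℕ) : ℕ := (s.2.1 ^ (k + 2) - s.2.2 ^ 2) / s.1 ^ 2

/-- Dividing m^g ≤ 64^g Y^(6k+12) by (tq)² ≥ Y^(4k+8) leaves a cofactor e ≤ 64^g Y^(2k+4). Together
with the O(Y^6) values of m, this saves Y² over the number of sieved triples. -/
theorem card_filter_large_square_le {k P Y : ℕ} (hY : 1 ≤ Y) (L : Finset (ℕ × ℕ × ℕ))
    (hL : ∀ s ∈ L, IsSievedTriple k P Y s.1 s.2.1 s.2.2 ∧ ∃ q : ℕ, q.Prime ∧ Y ^ (k + 4) < q ∧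
      ((q : ℤ) * s.1) ^ 2 ∣ (s.2.1 : ℤ) ^ (k + 2) - (s.2.2 : ℤ) ^ 2) :
    L.card ≤ 72 * (k + 3) ^ 2 * 64 ^ (k + 2) * Y ^ (2 * k + 10) := by
  have h := card_large_square_le (g := k + 2) (D := 64 ^ (k + 2) * Y ^ (2 * k + 4))
    (τ := (k + 2 + 1) ^ 2) (semiprimes Y) L ?_
    fun m hm => odd_and_card_divisors_of_mem_semiprimes hY hm (k + 2)
  · refine h.trans ?_
    calc 2 * (k + 2 + 1) ^ 2 * ((semiprimes Y).card * (64 ^ (k + 2) * Y ^ (2 * k + 4)))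
        ≤ 2 * (k + 2 + 1) ^ 2 * (36 * Y ^ 6 * (64 ^ (k + 2) * Y ^ (2 * k + 4))) :=
          Nat.mul_le_mul_left _ (Nat.mul_le_mul_right _ (card_semiprimes_le Y))
      _ = 72 * (k + 3) ^ 2 * 64 ^ (k + 2) * Y ^ (2 * k + 10) := by ring
  · intro s hs
    obtain ⟨hst, q, hq, hqY, hqd⟩ := hL s hs
    have hd : ((s.1 * q : ℕ) : ℤ) ^ 2 ∣ (s.2.1 : ℤ) ^ (k + 2) - (s.2.2 : ℤ) ^ 2 := by
      push_cast
      rwa [mul_comm (s.1 : ℤ)]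
    have heq := hst.eq_of_sq_dvd hd
    have hlt := hst.sq_lt
    refine ⟨hst.prime_t, hst.mem_m, hst.pos_n hY, hst.coprime.pow_right _, q, _, hq, ?_, ?_, heq⟩
    · refine Nat.pos_of_ne_zero fun h0 => ?_
      rw [h0, mul_zero, add_zero] at heq
      omega
    · set e := (s.2.1 ^ (k + 2) - s.2.2 ^ 2) / (s.1 * q) ^ 2 with he
      have ht := (mem_primesBlock.1 hst.mem_t).1.1
      have h1 : Y ^ (4 * k + 8) ≤ (s.1 * q) ^ 2 := by
        calc Y ^ (4 * k + 8) = (Y ^ k * Y ^ (k + 4)) ^ 2 := by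
              rw [← pow_add, ← pow_mul]; congr 1; ring
          _ ≤ (s.1 * q) ^ 2 := Nat.pow_le_pow_left (Nat.mul_le_mul ht.le hqY.le) 2
      have h2 : s.2.1 ^ (k + 2) ≤ 64 ^ (k + 2) * (Y ^ (4 * k + 8) * Y ^ (2 * k + 4)) := by
        calc s.2.1 ^ (k + 2) ≤ (64 * Y ^ 6) ^ (k + 2) :=
              Nat.pow_le_pow_left (bounds_of_mem_semiprimes hst.mem_m).2 _
          _ = 64 ^ (k + 2) * (Y ^ (4 * k + 8) * Y ^ (2 * k + 4)) := by
            rw [mul_pow, ← pow_mul, ← pow_add]; congr 2; ring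
      have h3 : Y ^ (4 * k + 8) * e ≤ Y ^ (4 * k + 8) * (64 ^ (k + 2) * Y ^ (2 * k + 4)) := by
        calc Y ^ (4 * k + 8) * e ≤ (s.1 * q) ^ 2 * e := Nat.mul_le_mul_right e h1
          _ ≤ s.2.1 ^ (k + 2) := by omega
          _ ≤ _ := h2
          _ = _ := by ring
      exact Nat.le_of_mul_le_mul_left h3 (by positivity)

/-- A square q² dividing d makes (qt)² divide m^g − n², which the sieve excludes for small q and
`hlarge` for large q. As t exceeds P, the divisibility of t²d by P passes to d, and 4P < Y < d gives
the size condition on the ramified primes. -/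
theorem discriminantOf_mem_classGroupSet {k l P Y : ℕ} (hk : 1 ≤ k) (hodd : Odd (k + 2))
    (hY64 : 64 ≤ Y) (hYP : 4 * P < Y) (p : Fin l → ℕ) (hpinj : Function.Injective p)
    (hp : ∀ i, (p i).Prime) (hpP : ∀ i, p i ∣ P) (hP0 : 0 < P) {s : ℕ × ℕ × ℕ}
    (hs : IsSievedTriple k P Y s.1 s.2.1 s.2.2)
    (hlarge : ∀ q : ℕ, q.Prime → Y ^ (k + 4) < q →
      ¬ ((q : ℤ) * s.1) ^ 2 ∣ (s.2.1 : ℤ) ^ (k + 2) - (s.2.2 : ℤ) ^ 2) :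
    discriminantOf k s ∈ classGroupSet ((Fin l → ZMod 2) × ZMod (k + 2))
      ((64 ^ (k + 2) * Y ^ (4 * k + 12) : ℕ) : ℝ) := by
  obtain ⟨t, m, n⟩ := s
  simp only at hs hlarge
  have heq := hs.eq_of_sq_dvd hs.sq_dvd
  set d := (m ^ (k + 2) - n ^ 2) / t ^ 2 with hd
  change d ∈ _
  have htp := hs.prime_t
  obtain ⟨ht1, ht2⟩ := (mem_primesBlock.1 hs.mem_t).1
  obtain ⟨hm1, hm2⟩ := bounds_of_mem_semiprimes hs.mem_m
  obtain ⟨hd1, hd2, hd3⟩ := discriminant_bounds hk hY64 ht1 ht2 hm1 hm2 hs.lt heq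
  have heqZ : (m : ℤ) ^ (k + 2) - (n : ℤ) ^ 2 = (t : ℤ) ^ 2 * d := by
    have : (m : ℤ) ^ (k + 2) = (n : ℤ) ^ 2 + (t : ℤ) ^ 2 * d := by exact_mod_cast heq
    linarith
  have hYd : Y < d := by
    have : Y ≤ Y ^ (4 * k + 12) := Nat.le_self_pow (by omega) Y
    omega
  have hsqf : Squarefree d := by
    rw [Nat.squarefree_iff_prime_squarefree]
    intro q hq hqd
    have h1 : ((q : ℤ) * t) ^ 2 ∣ (m : ℤ) ^ (k + 2) - (n : ℤ) ^ 2 := by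
      rw [heqZ, mul_pow, mul_comm]
      refine mul_dvd_mul_left _ ?_
      rw [sq]
      exact_mod_cast hqd
    rcases le_or_gt q (Y ^ (k + 4)) with h | h
    · exact hs.free q hq h h1
    · exact hlarge q hq h h1
  have htP : Nat.Coprime P t := by
    refine ((Nat.Prime.coprime_iff_not_dvd htp).2 fun h => ?_).symm
    have h1 := Nat.le_of_dvd hP0 h
    have h2 : Y ≤ Y ^ k := Nat.le_self_pow (by omega) Y
    omega
  have hPd : P ∣ d := by
    have h1 := hs.dvd
    rw [heqZ] at h1
    have h2 : P ∣ t ^ 2 * d := by exact_mod_cast h1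
    exact (htP.pow_right 2).dvd_of_dvd_mul_left h2
  have hprod : ∏ i, p i ∣ P := by
    classical
    have : ∏ q ∈ Finset.univ.image p, q ∣ P := by
      refine Finset.prod_primes_dvd _ ?_ ?_
      · intro a ha
        obtain ⟨i, -, rfl⟩ := Finset.mem_image.1 ha
        exact (hp i).prime
      · intro a ha
        obtain ⟨i, -, rfl⟩ := Finset.mem_image.1 ha
        exact hpP i
    rwa [Finset.prod_image fun i _ j _ h => hpinj h] at this
  have hprodle := Nat.le_of_dvd hP0 hprod
  have hmodd := (odd_and_card_divisors_of_mem_semiprimes (by omega) hs.mem_m (k + 2)).1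
  have hcop : Nat.Coprime m (2 * n) :=
    (Nat.coprime_two_right.2 hmodd).mul_right hs.coprime.symm
  exact ⟨by omega, hsqf, by exact_mod_cast hd2,
    embedsInClassGroup_of_repr hsqf (by omega) hodd p hpinj hp (fun i => (hpP i).trans hPd)
      (by omega) hd3 heq htp.pos hcop⟩

/-! ### Counting distinct d -/

/-- The counting argument, up to a loss factor `L`. -/
theorem le_classGroupCount_of_loss {k l P q₀ Y : ℕ} {L : ℝ} (hk : 1 ≤ k) (hodd : Odd (k + 2))
    (hP : Odd P) (hPsq : Squarefree P) (hPq₀ : ∀ q : ℕ, q.Prime → q ≤ q₀ → q ∣ 2 * P ^ 2)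
    (hq₀ : 16 ≤ q₀) (p : Fin l → ℕ) (hpinj : Function.Injective p) (hp : ∀ i, (p i).Prime)
    (hpP : ∀ i, p i ∣ P) (hL : 1 ≤ L) (hYP : 4 * P ^ 2 < Y) (hY64 : 64 ≤ Y)
    (hYP' : 640 * P ^ 2 ≤ Y ^ 2)
    (hT : (Y : ℝ) ^ k ≤ L * (primesBlock (Y ^ k)).card)
    (hB : (Y : ℝ) ^ 3 ≤ L * (primesBlock (2 * Y ^ 3)).card)
    (hτ : ∀ n : ℕ, n ≤ 16 * 64 ^ (k + 2) * Y ^ (8 * k + 12) → (n.divisors.card : ℝ) ≤ L)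
    (hYL : 6144 * P ^ 4 * (72 * (k + 3) ^ 2 * 64 ^ (k + 2)) * L ^ 3 ≤ (Y : ℝ) ^ 2) :
    (Y : ℝ) ^ (2 * k + 12) / (41472 * 6144 ^ 2 * P ^ 8 * L ^ 7) ≤
      classGroupCount ((Fin l → ZMod 2) × ZMod (k + 2))
        ((64 ^ (k + 2) * Y ^ (4 * k + 12) : ℕ) : ℝ) := by
  classical
  have hP0 : 0 < P := hP.pos
  have hPr : (1 : ℝ) ≤ P := by exact_mod_cast hP0
  have hY1 : 1 ≤ Y := by omega
  have hYr : (0 : ℝ) < Y := by exact_mod_cast hY1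
  have hL0 : 0 < L := by linarith
  set C : ℝ := 72 * (k + 3) ^ 2 * 64 ^ (k + 2) with hC
  have hC1 : 1 ≤ C := by
    have h1 : (1 : ℝ) ≤ ((k : ℝ) + 3) ^ 2 := one_le_pow₀ (by linarith [(Nat.cast_nonneg k : (0 : ℝ) ≤ k)])
    have h2 : (1 : ℝ) ≤ 64 ^ (k + 2) := one_le_pow₀ (by norm_num)
    nlinarith
  have hP4 : (1 : ℝ) ≤ (P : ℝ) ^ 4 := one_le_pow₀ hPr
  have hLY : L ≤ (Y : ℝ) ^ 2 := by
    refine le_trans ?_ hYL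
    have h1 : L ≤ L ^ 3 := le_self_pow₀ hL (by norm_num)
    have h2 : 1 ≤ 6144 * (P : ℝ) ^ 4 * C := by nlinarith
    nlinarith
  have hPP : P ≤ P ^ 2 := Nat.le_self_pow two_ne_zero P
  obtain ⟨S, hS, hScard⟩ := exists_sieved_triples hk hP hPsq hPq₀ hq₀ hL (by omega) hY64 hYP' hT hB
    hLY
  set Z : ℝ := (Y : ℝ) ^ (2 * k + 12) with hZ
  have hZ0 : 0 < Z := by positivity
  let bad : ℕ × ℕ × ℕ → Prop := fun s => ∃ q : ℕ, q.Prime ∧ Y ^ (k + 4) < q ∧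
      ((q : ℤ) * s.1) ^ 2 ∣ (s.2.1 : ℤ) ^ (k + 2) - (s.2.2 : ℤ) ^ 2
  set S' := S.filter fun s => ¬ bad s with hS'
  have hbad : ((S.filter bad).card : ℝ) ≤ C * (Y : ℝ) ^ (2 * k + 10) := by
    have := card_filter_large_square_le hY1 (S.filter bad) fun s hs =>
      ⟨hS s (Finset.mem_filter.1 hs).1, (Finset.mem_filter.1 hs).2⟩
    rw [hC]
    exact_mod_cast this
  -- Half of the lower bound for the number of triples; by `hYL` the other half covers those with a
  -- large square factor.
  set A : ℝ := Z / (6144 * P ^ 4 * L ^ 3) with hA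
  have hA0 : 0 < A := by positivity
  have hS'card : A ≤ S'.card := by
    have h1 : ((S.filter bad).card : ℝ) + S'.card = S.card := by
      exact_mod_cast Finset.card_filter_add_card_filter_not (s := S) bad
    have h2 : 2 * A ≤ S.card := by
      have : 2 * A = Z / (3072 * P ^ 4 * L ^ 3) := by rw [hA]; field_simp; norm_num
      rw [this, div_le_iff₀ (by positivity)]
      linarith
    have h3 : C * (Y : ℝ) ^ (2 * k + 10) ≤ A := by
      rw [hA, le_div_iff₀ (by positivity)]
      calc C * (Y : ℝ) ^ (2 * k + 10) * (6144 * P ^ 4 * L ^ 3)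
          = (Y : ℝ) ^ (2 * k + 10) * (6144 * P ^ 4 * C * L ^ 3) := by ring
        _ ≤ (Y : ℝ) ^ (2 * k + 10) * Y ^ 2 := by gcongr
        _ = Z := by rw [hZ]; ring
    linarith
  have hS'mem : ∀ s ∈ S', IsSievedTriple k P Y s.1 s.2.1 s.2.2 := fun s hs =>
    hS s (Finset.mem_filter.1 hs).1
  -- distinct discriminants
  have hcoll := card_collisions_le (g := k + 2) (τ := ⌊L⌋₊) (by omega) (primesBlock (Y ^ k))
    (semiprimes Y) S' (discriminantOf k)
    (fun s hs => by
      have h := hS'mem s hs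
      exact ⟨h.mem_t, h.mem_m, h.pos_n hY1, h.eq_of_sq_dvd h.sq_dvd, h.prime_t, h.not_dvd⟩)
    (fun t₁ ht₁ t₂ ht₂ m₁ hm₁ m₂ hm₂ => by
      refine Nat.le_floor (hτ _ ?_)
      have hb : ∀ t ∈ primesBlock (Y ^ k), ∀ m ∈ semiprimes Y,
          t ^ 2 * m ^ (k + 2) ≤ 16 * 64 ^ (k + 2) * Y ^ (8 * k + 12) := by
        intro t ht m hm
        calc t ^ 2 * m ^ (k + 2) ≤ (4 * Y ^ k) ^ 2 * (64 * Y ^ 6) ^ (k + 2) :=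
              Nat.mul_le_mul (Nat.pow_le_pow_left (mem_primesBlock.1 ht).1.2 2)
                (Nat.pow_le_pow_left (bounds_of_mem_semiprimes hm).2 _)
          _ = 16 * 64 ^ (k + 2) * Y ^ (8 * k + 12) := by
            rw [mul_pow, mul_pow, ← pow_mul, ← pow_mul,
              show 8 * k + 12 = k * 2 + 6 * (k + 2) by ring, pow_add]
            ring
      have h1 := hb t₁ ht₁ m₂ hm₂
      have h2 := hb t₂ ht₂ m₁ hm₁
      have h3 : ((t₁ : ℤ) ^ 2 * (m₂ : ℤ) ^ (k + 2) - (t₂ : ℤ) ^ 2 * (m₁ : ℤ) ^ (k + 2)) =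
          ((t₁ ^ 2 * m₂ ^ (k + 2) : ℕ) : ℤ) - ((t₂ ^ 2 * m₁ ^ (k + 2) : ℕ) : ℤ) := by
        push_cast; ring
      rw [h3]
      omega)
  set D := S'.image (discriminantOf k) with hD
  have hcs := Finset.sq_card_le_card_image_mul_card_pairs S' (discriminantOf k)
  rw [← hD] at hcs
  set E : ℝ := 20736 * Z * L with hE
  have hTM : ((primesBlock (Y ^ k)).card * (semiprimes Y).card) ^ 2 ≤
      (144 * Y ^ (k + 6)) ^ 2 := by
    refine Nat.pow_le_pow_left ?_ 2
    calc (primesBlock (Y ^ k)).card * (semiprimes Y).card ≤ (3 * Y ^ k) * (36 * Y ^ 6) :=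
          Nat.mul_le_mul (card_primesBlock_le _) (card_semiprimes_le Y)
      _ = 108 * Y ^ (k + 6) := by ring
      _ ≤ 144 * Y ^ (k + 6) := Nat.mul_le_mul_right _ (by norm_num)
  have hcoll' : (((S' ×ˢ S').filter fun x =>
      discriminantOf k x.1 = discriminantOf k x.2).card : ℝ) ≤ S'.card + E := by
    have h1 : ((((primesBlock (Y ^ k)).card * (semiprimes Y).card) ^ 2 : ℕ) : ℝ) ≤
        ((144 * Y ^ (k + 6)) ^ 2 : ℕ) := by exact_mod_cast hTM
    have h2 : ((⌊L⌋₊ : ℕ) : ℝ) ≤ L := Nat.floor_le hL0.le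
    calc (((S' ×ˢ S').filter fun x => discriminantOf k x.1 = discriminantOf k x.2).card : ℝ)
        ≤ ((S'.card + ((primesBlock (Y ^ k)).card * (semiprimes Y).card) ^ 2 * ⌊L⌋₊ : ℕ) : ℝ) := by
          exact_mod_cast hcoll
      _ = S'.card + ((((primesBlock (Y ^ k)).card * (semiprimes Y).card) ^ 2 : ℕ) : ℝ) * ⌊L⌋₊ := by
          push_cast; ring
      _ ≤ S'.card + ((144 * Y ^ (k + 6)) ^ 2 : ℕ) * L := by gcongr
      _ = S'.card + E := by rw [hE, hZ]; push_cast; ring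
  -- Cauchy–Schwarz gives x²/(x + E) with x the number of triples. Since A ≤ x and A ≤ E, this is at
  -- least A²/(2E) whichever of x and E is larger.
  have hDlow : A ^ 2 / (2 * E) ≤ D.card := by
    have hE0 : 0 < E := by positivity
    have hAE : A ≤ E := by
      rw [hA, hE, div_le_iff₀ (by positivity)]
      have h1 : (1 : ℝ) ≤ L ^ 3 := one_le_pow₀ hL
      have h2 : 1 ≤ 20736 * L * (6144 * P ^ 4 * L ^ 3) := by
        have : 1 ≤ (P : ℝ) ^ 4 * L ^ 3 := one_le_mul_of_one_le_of_one_le hP4 h1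
        nlinarith
      nlinarith
    have hcs' : (S'.card : ℝ) ^ 2 ≤ D.card * (S'.card + E) := by
      refine le_trans (by exact_mod_cast hcs) (mul_le_mul_of_nonneg_left hcoll' (Nat.cast_nonneg _))
    rw [div_le_iff₀ (by positivity)]
    have hx0 : (0 : ℝ) < S'.card := hA0.trans_le hS'card
    rcases le_or_gt (S'.card : ℝ) E with h | h
    · calc A ^ 2 ≤ (S'.card : ℝ) ^ 2 := pow_le_pow_left₀ hA0.le hS'card 2
        _ ≤ D.card * (S'.card + E) := hcs'
        _ ≤ D.card * (2 * E) := by gcongr; linarith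
    · have h1 : (S'.card : ℝ) * S'.card ≤ (D.card * 2) * S'.card := by
        calc (S'.card : ℝ) * S'.card = (S'.card : ℝ) ^ 2 := (sq _).symm
          _ ≤ D.card * (S'.card + E) := hcs'
          _ ≤ D.card * (S'.card + S'.card) := by gcongr
          _ = (D.card * 2) * S'.card := by ring
      have h2 := le_of_mul_le_mul_right h1 hx0
      calc A ^ 2 = A * A := sq A
        _ ≤ E * E := mul_le_mul hAE hAE hA0.le hE0.le
        _ ≤ (D.card * 2) * E := by gcongr; linarith
        _ = D.card * (2 * E) := by ring
  have hDsub : D.card ≤ classGroupCount ((Fin l → ZMod 2) × ZMod (k + 2))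
      ((64 ^ (k + 2) * Y ^ (4 * k + 12) : ℕ) : ℝ) := by
    rw [classGroupCount, ← Set.ncard_coe_finset]
    refine Set.ncard_le_ncard ?_ (classGroupSet_finite _ _)
    intro d hd
    obtain ⟨s, hs, rfl⟩ := Finset.mem_image.1 (Finset.mem_coe.1 hd)
    refine discriminantOf_mem_classGroupSet hk hodd hY64 (by omega) p hpinj hp hpP hP0
      (hS'mem s hs) fun q hq hqY hqd => ?_
    exact (Finset.mem_filter.1 hs).2 ⟨q, hq, hqY, hqd⟩
  have hDsub' : (D.card : ℝ) ≤ classGroupCount ((Fin l → ZMod 2) × ZMod (k + 2))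
      ((64 ^ (k + 2) * Y ^ (4 * k + 12) : ℕ) : ℝ) := by exact_mod_cast hDsub
  refine le_trans (le_of_eq ?_) (hDlow.trans hDsub')
  rw [hA, hE]
  field_simp
  norm_num

/-! ### Choice of the modulus, of the loss factor, and passage to X -/

/-- An odd square-free modulus with at least `l` prime factors which, together with `2`, contains
all small primes. -/
theorem exists_odd_squarefree_modulus (l : ℕ) :
    ∃ (P q₀ : ℕ) (p : Fin l → ℕ), Odd P ∧ Squarefree P ∧ 16 ≤ q₀ ∧
      (∀ q : ℕ, q.Prime → q ≤ q₀ → q ∣ 2 * P ^ 2) ∧ Function.Injective p ∧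
      (∀ i, (p i).Prime) ∧ ∀ i, p i ∣ P := by
  classical
  set q₀ := Nat.nth Nat.Prime (l + 1) + 16 with hq₀
  set s := (Finset.range (q₀ + 1)).filter fun q => q.Prime ∧ q ≠ 2 with hs
  have hmem : ∀ q ∈ s, q.Prime ∧ q ≠ 2 := fun q hq => (Finset.mem_filter.1 hq).2
  have hsmono : StrictMono (Nat.nth Nat.Prime) :=
    Nat.nth_strictMono Nat.infinite_setOfPred_prime
  have hdvd : ∀ q : ℕ, q.Prime → q ≠ 2 → q ≤ q₀ → q ∣ ∏ q ∈ s, q := fun q hq hq2 hle =>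
    Finset.dvd_prod_of_mem (fun q => q)
      (Finset.mem_filter.2 ⟨Finset.mem_range.2 (by omega), hq, hq2⟩)
  -- The shift to i + 1 skips the prime 2, which has index 0.
  refine ⟨∏ q ∈ s, q, q₀, fun i => Nat.nth Nat.Prime (i + 1), ?_, ?_, by omega, ?_, ?_, ?_, ?_⟩
  · exact Finset.prod_induction (fun q => q) Odd (fun _ _ => Odd.mul) odd_one
      fun q hq => (hmem q hq).1.odd_of_ne_two (hmem q hq).2
  · refine Finset.squarefree_prod_of_pairwise_isCoprime ?_ fun q hq => (hmem q hq).1.squarefree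
    intro a ha b hb hab
    exact Nat.coprime_iff_isRelPrime.1
      ((Nat.coprime_primes (hmem a ha).1 (hmem b hb).1).2 hab)
  · intro q hq hle
    by_cases hq2 : q = 2
    · exact hq2 ▸ dvd_mul_right _ _
    · exact ((hdvd q hq hq2 hle).trans (dvd_pow_self _ two_ne_zero)).mul_left 2
  · intro i j hij
    have := hsmono.injective hij
    exact Fin.ext (by omega)
  · exact fun i => Nat.prime_nth_prime _
  · intro i
    refine hdvd _ (Nat.prime_nth_prime _) ?_ ?_
    · have h1 := hsmono (show 0 < (i : ℕ) + 1 by omega)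
      have h2 := (Nat.prime_nth_prime 0).two_le
      exact (h2.trans_lt h1).ne'
    · have h1 := hsmono (show (i : ℕ) + 1 < l + 1 by omega)
      exact h1.le.trans (Nat.le_add_right _ _)

-- One loss factor L = C'Y^η serves for both the primes and the divisors. The integers concerned are
-- at most a constant times Y^(8k+12), which dictates δ = η/(8k+12), and 3η ≤ 1 keeps L³ below a
-- constant times Y. The exponent 7η comes from L⁷.
open Filter in
theorem exists_le_classGroupCount_nat {k : ℕ} (l : ℕ) (hk : 1 ≤ k) (hodd : Odd (k + 2)) {η : ℝ}
    (hη : 0 < η) (hη' : 3 * η ≤ 1) :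
    ∃ c : ℝ, 0 < c ∧ ∀ᶠ Y : ℕ in atTop, c * (Y : ℝ) ^ ((2 * k + 12 : ℕ) - 7 * η : ℝ) ≤
      classGroupCount ((Fin l → ZMod 2) × ZMod (k + 2))
        ((64 ^ (k + 2) * Y ^ (4 * k + 12) : ℕ) : ℝ) := by
  obtain ⟨P, q₀, p, hP, hPsq, hq₀, hPq₀, hpinj, hp, hpP⟩ := exists_odd_squarefree_modulus l
  set δ : ℝ := η / (8 * k + 12 : ℕ) with hδ
  have hδ0 : 0 < δ := by positivity
  obtain ⟨C, hC1, hC⟩ := exists_card_divisors_le_rpow hδ0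
  set R : ℝ := ((16 * 64 ^ (k + 2) : ℕ) : ℝ) with hR
  have hR1 : 1 ≤ R := by
    have : 1 ≤ 16 * 64 ^ (k + 2) := Nat.one_le_iff_ne_zero.2 (by positivity)
    rw [hR]
    exact_mod_cast this
  set C' : ℝ := C * R ^ δ with hC'
  have hRδ : 1 ≤ R ^ δ := Real.one_le_rpow hR1 hδ0.le
  have hC'1 : 1 ≤ C' := one_le_mul_of_one_le_of_one_le hC1 hRδ
  have hP0 : 0 < P := hP.pos
  have hPr : (0 : ℝ) < P := by exact_mod_cast hP0
  set K : ℝ := 6144 * P ^ 4 * (72 * (k + 3) ^ 2 * 64 ^ (k + 2)) * C' ^ 3 with hK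
  refine ⟨1 / (41472 * 6144 ^ 2 * P ^ 8 * C' ^ 7), by positivity, ?_⟩
  have hprimes := eventually_rpow_le_card_primes hδ0
  have hTtend : Tendsto (fun Y : ℕ => Y ^ k) atTop atTop := tendsto_pow_atTop (by omega)
  have hBtend : Tendsto (fun Y : ℕ => 2 * Y ^ 3) atTop atTop :=
    (tendsto_pow_atTop (by norm_num)).const_mul_atTop' two_pos
  filter_upwards [hTtend.eventually hprimes, hBtend.eventually hprimes,
    eventually_ge_atTop (640 * P ^ 2 + 64), tendsto_natCast_atTop_atTop.eventually_ge_atTop K]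
    with Y hT hB hY hYK
  have hY1 : 1 ≤ Y := by omega
  have hYr : (1 : ℝ) ≤ Y := by exact_mod_cast hY1
  have hY0 : (0 : ℝ) < Y := by linarith
  set L : ℝ := C' * (Y : ℝ) ^ η with hL
  have hYη : 1 ≤ (Y : ℝ) ^ η := Real.one_le_rpow hYr hη.le
  have hL1 : 1 ≤ L := one_le_mul_of_one_le_of_one_le hC'1 hYη
  have hsmall : ∀ n : ℕ, n ≤ 16 * 64 ^ (k + 2) * Y ^ (8 * k + 12) → C * (n : ℝ) ^ δ ≤ L := by
    intro n hn
    have h1 : (n : ℝ) ≤ R * (Y : ℝ) ^ (8 * k + 12) := by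
      rw [hR]; exact_mod_cast hn
    have h2 : (n : ℝ) ^ δ ≤ R ^ δ * (Y : ℝ) ^ η := by
      calc (n : ℝ) ^ δ ≤ (R * (Y : ℝ) ^ (8 * k + 12)) ^ δ :=
            Real.rpow_le_rpow (Nat.cast_nonneg n) h1 hδ0.le
        _ = R ^ δ * (Y : ℝ) ^ η := by
          rw [Real.mul_rpow (by linarith) (by positivity), ← Real.rpow_natCast,
            ← Real.rpow_mul hY0.le, hδ, mul_div_cancel₀ _ (by positivity)]
    calc C * (n : ℝ) ^ δ ≤ C * (R ^ δ * (Y : ℝ) ^ η) := by gcongr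
      _ = L := by rw [hL, hC']; ring
  have hblock : ∀ z : ℕ, 0 < z → z ≤ 16 * 64 ^ (k + 2) * Y ^ (8 * k + 12) →
      (z : ℝ) ^ (1 - δ) ≤ (primesBlock z).card → (z : ℝ) ≤ L * (primesBlock z).card := by
    intro z hz0 hz h
    have hzr : (0 : ℝ) < z := by exact_mod_cast hz0
    have h1 : (z : ℝ) ^ δ ≤ L := by
      refine le_trans ?_ (hsmall z hz)
      exact le_mul_of_one_le_left (by positivity) hC1
    calc (z : ℝ) = (z : ℝ) ^ δ * (z : ℝ) ^ (1 - δ) := by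
          rw [← Real.rpow_add hzr, add_sub_cancel, Real.rpow_one]
      _ ≤ L * (primesBlock z).card := mul_le_mul h1 h (by positivity) (by linarith)
  have h16 : 16 ≤ 16 * 64 ^ (k + 2) := Nat.le_mul_of_pos_right _ (by positivity)
  have hT' : (Y : ℝ) ^ k ≤ L * (primesBlock (Y ^ k)).card := by
    have := hblock (Y ^ k) (by positivity) (by
      calc Y ^ k ≤ Y ^ (8 * k + 12) := Nat.pow_le_pow_right hY1 (by omega)
        _ ≤ _ := Nat.le_mul_of_pos_left _ (by positivity)) hT
    exact_mod_cast this
  have hB' : (Y : ℝ) ^ 3 ≤ L * (primesBlock (2 * Y ^ 3)).card := by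
    have := hblock (2 * Y ^ 3) (by positivity)
      (Nat.mul_le_mul (by omega) (Nat.pow_le_pow_right hY1 (by omega))) hB
    push_cast at this
    have h3 : (0 : ℝ) ≤ (Y : ℝ) ^ 3 := by positivity
    linarith
  have hYL : 6144 * P ^ 4 * (72 * (k + 3) ^ 2 * 64 ^ (k + 2)) * L ^ 3 ≤ (Y : ℝ) ^ 2 := by
    have h1 : ((Y : ℝ) ^ η) ^ 3 ≤ Y := by
      rw [← Real.rpow_natCast, ← Real.rpow_mul hY0.le]
      calc (Y : ℝ) ^ (η * (3 : ℕ)) ≤ (Y : ℝ) ^ (1 : ℝ) :=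
            Real.rpow_le_rpow_of_exponent_le hYr (by push_cast; linarith)
        _ = Y := Real.rpow_one _
    calc 6144 * P ^ 4 * (72 * (k + 3) ^ 2 * 64 ^ (k + 2)) * L ^ 3
        = K * ((Y : ℝ) ^ η) ^ 3 := by rw [hL, hK]; ring
      _ ≤ (Y : ℝ) * Y := mul_le_mul hYK h1 (by positivity) hY0.le
      _ = (Y : ℝ) ^ 2 := (sq _).symm
  have hPY : P ^ 2 ≤ 640 * P ^ 2 := Nat.le_mul_of_pos_left _ (by norm_num)
  have hmain := le_classGroupCount_of_loss hk hodd hP hPsq hPq₀ hq₀ p hpinj hp hpP hL1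
    (by omega) (by omega) (by nlinarith) hT' hB' (fun n hn => (hC n).trans (hsmall n hn)) hYL
  refine le_trans (le_of_eq ?_) hmain
  have hpow : ((Y : ℝ) ^ η) ^ 7 = (Y : ℝ) ^ (7 * η) := by
    rw [← Real.rpow_natCast, ← Real.rpow_mul hY0.le, mul_comm]; norm_num
  rw [Real.rpow_sub hY0, Real.rpow_natCast, hL, mul_pow C', hpow]
  field_simp

theorem classGroupCount_mono (H : Type) [AddCommGroup H] {X Y : ℝ} (h : X ≤ Y) :
    classGroupCount H X ≤ classGroupCount H Y :=
  Set.ncard_le_ncard (fun _ hd => ⟨hd.1, hd.2.1, hd.2.2.1.trans h, hd.2.2.2⟩)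
    (classGroupSet_finite H Y)

end

theorem theorem2p1 (l : ℕ) (hl : 2 ≤ l) (g₁ : ℕ) (hg : 3 ≤ g₁) (hodd : Odd g₁)
    (ε : ℝ) (hε : 0 < ε) :
    ∃ c : ℝ, 0 < c ∧ ∃ X₀ : ℝ, ∀ X : ℝ, X₀ ≤ X →
      c * X ^ ((1 : ℝ) / 2 + 3 / (2 * (g₁ : ℝ) + 2) - ε) ≤
        (classGroupCount ((Fin l → ZMod 2) × ZMod g₁) X : ℝ) := by
  obtain ⟨k, rfl⟩ : ∃ k, g₁ = k + 2 := ⟨g₁ - 2, by omega⟩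
  have hk : 1 ≤ k := by omega
  set n : ℕ := 4 * k + 12 with hn
  have hn0 : (0 : ℝ) < n := by positivity
  -- The loss Y^(7η) is at most X^ε up to constants, because X has size Y^n; the minimum with 1
  -- secures 3η ≤ 1 and a non-negative exponent e.
  set η : ℝ := min (ε * n) 1 / 7 with hη
  have hη0 : 0 < η := by positivity
  have hη1 : 7 * η ≤ 1 := by rw [hη]; linarith [min_le_right (ε * n) 1]
  have hηε : 7 * η ≤ ε * n := by rw [hη]; linarith [min_le_left (ε * n) 1]
  obtain ⟨c, hc, hev⟩ := exists_le_classGroupCount_nat l hk hodd hη0 (by linarith)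
  obtain ⟨Y₀, hY₀⟩ := Filter.eventually_atTop.1 hev
  set e : ℝ := (2 * k + 12 : ℕ) - 7 * η with he
  have he0 : 0 ≤ e := by
    have : (0 : ℝ) ≤ k := Nat.cast_nonneg k
    rw [he]; push_cast; linarith
  set a : ℝ := 64 ^ (k + 2) with ha
  have ha0 : 0 < a := by positivity
  have ha1 : 1 ≤ a := one_le_pow₀ (by norm_num)
  refine ⟨c / (2 ^ e * (a ^ (1 / n : ℝ)) ^ e), by positivity, a * ((Y₀ : ℝ) + 1) ^ n, ?_⟩
  intro X hX
  have hY1 : (1 : ℝ) ≤ (Y₀ : ℝ) + 1 := by linarith [(Nat.cast_nonneg Y₀ : (0 : ℝ) ≤ Y₀)]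
  have hX1 : 1 ≤ X := (one_le_mul_of_one_le_of_one_le ha1 (one_le_pow₀ hY1)).trans hX
  have hX0 : 0 < X := by linarith
  set u : ℝ := (X / a) ^ (1 / n : ℝ) with hu
  have hu0 : 0 ≤ u := by positivity
  have hun : u ^ n = X / a := by
    rw [hu, ← Real.rpow_natCast, ← Real.rpow_mul (by positivity), one_div_mul_cancel hn0.ne',
      Real.rpow_one]
  have huY : (Y₀ : ℝ) + 1 ≤ u := by
    refine le_of_pow_le_pow_left₀ (by omega : n ≠ 0) hu0 ?_
    rw [hun, le_div_iff₀ ha0]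
    linarith
  set Y := ⌊u⌋₊ with hY
  have hYu : (Y : ℝ) ≤ u := Nat.floor_le hu0
  have hYu' : u / 2 ≤ Y := by
    have h1 := Nat.lt_floor_add_one u
    have h2 : (1 : ℝ) ≤ Y := by exact_mod_cast Nat.le_floor (n := 1) (by push_cast; linarith)
    rw [← hY] at h1
    linarith
  have hYY : Y₀ ≤ Y := Nat.le_floor (by linarith)
  have hcount := hY₀ Y hYY
  have hle : ((64 ^ (k + 2) * Y ^ n : ℕ) : ℝ) ≤ X := by
    push_cast
    calc a * (Y : ℝ) ^ n ≤ a * u ^ n := by gcongr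
      _ = X := by rw [hun, mul_div_cancel₀ _ ha0.ne']
  have hmono := classGroupCount_mono ((Fin l → ZMod 2) × ZMod (k + 2)) hle
  have hmono' : (classGroupCount ((Fin l → ZMod 2) × ZMod (k + 2))
      ((64 ^ (k + 2) * Y ^ n : ℕ) : ℝ) : ℝ) ≤
      classGroupCount ((Fin l → ZMod 2) × ZMod (k + 2)) X := by exact_mod_cast hmono
  refine le_trans ?_ (hcount.trans hmono')
  have hexp : X ^ ((1 : ℝ) / 2 + 3 / (2 * ((k + 2 : ℕ) : ℝ) + 2) - ε) ≤ X ^ (1 / n * e : ℝ) := by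
    refine Real.rpow_le_rpow_of_exponent_le hX1 ?_
    have h1 : (1 : ℝ) / 2 + 3 / (2 * ((k + 2 : ℕ) : ℝ) + 2) = (2 * k + 12 : ℕ) / n := by
      rw [hn]; push_cast
      have : (k : ℝ) + 3 ≠ 0 := by positivity
      field_simp
      ring
    have h2 : 1 / (n : ℝ) * e = (2 * k + 12 : ℕ) / n - 7 * η / n := by rw [he]; ring
    have h3 : 7 * η / n ≤ ε := by rwa [div_le_iff₀ hn0]
    linarith
  have hue : u ^ e = X ^ (1 / n * e : ℝ) / (a ^ (1 / n : ℝ)) ^ e := by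
    rw [hu, Real.div_rpow hX0.le ha0.le, Real.div_rpow (by positivity) (by positivity),
      ← Real.rpow_mul hX0.le]
  calc c / (2 ^ e * (a ^ (1 / n : ℝ)) ^ e) *
        X ^ ((1 : ℝ) / 2 + 3 / (2 * ((k + 2 : ℕ) : ℝ) + 2) - ε)
      ≤ c / (2 ^ e * (a ^ (1 / n : ℝ)) ^ e) * X ^ (1 / n * e : ℝ) := by gcongr
    _ = c * (u / 2) ^ e := by
      rw [Real.div_rpow hu0 (by norm_num), hue]
      field_simp
    _ ≤ c * (Y : ℝ) ^ e := by gcongr
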